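/- Let $n,m\ge 1$ be integers and let $\rho\in(0,1)$. Put $p=\frac1{1+\rho}\in(\frac12,1)$, so that $\rho=\frac{1-p}{p}$, and $Z_\rho=\frac{\ln(1-\rho)}{\ln\rho}$. Consider the frog model on $\mathbb Z$ with $n$ frogs at every site: at time $0$ the $n$ frogs at the origin are active and all other frogs are asleep. Active frogs perform, in discrete time, simultaneously and independently, nearest-neighbour random walks that step to the right with probability $p$ and to the left with probability $1-p$. When an active frog visits a site, all frogs sleeping there become active and start such walks from that site. Let $\widetilde X_{\rho,n}$ be minus the leftmost site ever visited by an active frog ($\widetilde X_{\rho,n}=\infty$ if there is no leftmost visited site). Write $f(\rho)\sim g(\rho)$ as $\rho\uparrow1$ if $f(\rho)/g(\rho)\to1$ as $\rho\uparrow 1$. Then the following holds. (a) There is a function $\phi:(0,1)\to[0,\infty)$ such that $E\bigl(\widetilde X_{\rho,n}^m\bigr)\le\phi(\rho)$ for all $\rho\in(0,1)$ and $$\phi(\rho)\sim Z_\rho^m\Bigl(\frac{1-\rho}{2\pi}\Bigr)^{n/2}\exp\Bigl\{\frac{\pi^2}{6}\,\frac{mn}{1-\rho}\Bigr\}\qquad\text{as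 }\rho\uparrow1.$$ (b) For every function $\delta:(0,1)\to(0,1)$ with $\lim_{\rho\uparrow1}\delta(\rho)=0$ and $\lim_{\rho\uparrow1}(1-\rho)^{\delta(\rho)}=0$ there is a function $\psi_\delta:(0,1)\to[0,\infty)$ such that $E\bigl(\widetilde X_{\rho,n}^m\bigr)\ge\psi_\delta(\rho)$ for all $\rho\in(0,1)$ and $$\psi_\delta(\rho)\sim m!\,Z_\rho^m\exp\Bigl\{\frac{mn}{(1-\rho)^{\delta(\rho)}}\Bigr\}\qquad\text{as }\rho\uparrow1.$$ -/

import Mathlib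

open MeasureTheory Filter Topology
open scoped ENNReal NNReal Asymptotics

namespace FrogModel

/-- The probability `p` of a step to the right, as a function of the drift constant
`ρ = (1 - p) / p`. -/
noncomputable def rightProb (ρ : ℝ) : ℝ := 1 / (1 + ρ)

/-- The law of one step of the underlying random walk: `+1` with probability `p`,
`-1` with probability `1 - p`. -/
noncomputable def stepLaw (ρ : Set.Ioo (0 : ℝ) 1) : Measure ℤ :=
  ENNReal.ofReal (rightProb ρ) • Measure.dirac 1 +
    ENNReal.ofReal (1 - rightProb ρ) • Measure.dirac (-1)

instance (ρ : Set.Ioo (0 : ℝ) 1) : IsProbabilityMeasure (stepLaw ρ) := by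
  obtain ⟨r, h0, h1⟩ := ρ
  have hp : 0 ≤ rightProb r := by unfold rightProb; positivity
  have hq : 0 ≤ 1 - rightProb r := by
    unfold rightProb
    rw [sub_nonneg, div_le_one (by linarith)]
    linarith
  constructor
  simp only [stepLaw, Measure.coe_add, Measure.coe_smul, Pi.add_apply, Pi.smul_apply,
    measure_univ, smul_eq_mul, mul_one]
  rw [← ENNReal.ofReal_add hp hq]
  simp

/-- A sample point: `ω (x, i, k)` is the step number `k` (counted from the activation of the
frog) of the frog with label `i` whose initial location is the site `x`. -/
abbrev Sample : Type := ℤ × ℕ × ℕ → ℤ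

/-- All steps of all frogs are independent with law `stepLaw ρ`. -/
noncomputable def law (ρ : Set.Ioo (0 : ℝ) 1) : Measure Sample :=
  Measure.infinitePi (fun _ : ℤ × ℕ × ℕ => stepLaw ρ)

/-- The location of the frog `i` of the site `x` once it has made `k` steps. -/
def position (ω : Sample) (x : ℤ) (i k : ℕ) : ℤ := x + ∑ j ∈ Finset.range k, ω (x, i, j)

open scoped Classical in
/-- The frog model with initial configuration `η` (the `η x` frogs of the site `x` carry the
labels `i < η x`). `clock η ω t x` is `none` if at time `t` the frogs of the site `x` are still
asleep, and `some k` if at time `t` they are active and have made `k` steps. At time `0` only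
the frogs of the origin are active. Sleeping frogs are activated (and start walking with the
next time step) when an active frog arrives at their site. -/
noncomputable def clock (η : ℤ → ℕ) (ω : Sample) : ℕ → ℤ → Option ℕ
  | 0, x => if x = 0 then some 0 else none
  | t + 1, x =>
    match clock η ω t x with
    | some k => some (k + 1)
    | none =>
      if ∃ (y : ℤ) (i k : ℕ), i < η y ∧ clock η ω t y = some k ∧ position ω y i (k + 1) = x
      then some 0 else none

/-- The sites that are occupied by an active frog at some time. -/
def visited (η : ℤ → ℕ) (ω : Sample) : Set ℤ :=
  {x | ∃ (t : ℕ) (y : ℤ) (i k : ℕ), i < η y ∧ clock η ω t y = some k ∧ position ω y i k = x}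

/-- Minus the leftmost visited site; it is `∞` if there is no leftmost visited site.
(The origin is visited as soon as `0 < η 0`, so visited sites `x > 0` play no role and may
contribute `0`.) -/
noncomputable def minusLeftmost (η : ℤ → ℕ) (ω : Sample) : ℝ≥0∞ :=
  ⨆ x ∈ visited η ω, ((-x).toNat : ℝ≥0∞)

/-- The `m`-th moment, in `[0, ∞]`, of minus the leftmost visited site in the frog model with
drift constant `ρ` that starts with `n` frogs on every site of `ℤ`. -/
noncomputable def moment (n m : ℕ) (ρ : Set.Ioo (0 : ℝ) 1) : ℝ≥0∞ :=
  ∫⁻ ω, minusLeftmost (fun _ => n) ω ^ m ∂(law ρ)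

/-- `Z_ρ = ln (1 - ρ) / ln ρ`. -/
noncomputable def Z (ρ : ℝ) : ℝ := Real.log (1 - ρ) / Real.log ρ

end FrogModel

/-! Call `-k` a renewal if no frog from a site `x ≥ -k` ever walks to the left of `-k`
(`halfLineStays`), where every frog is given its walk whether or not it is ever woken. Almost
surely, minus the leftmost visited site is the first such `k`: nothing to the left of a renewal
wakes up (`minusLeftmost_le`), and before the first renewal the awake region keeps growing to the
left (`le_minusLeftmost`). By gambler's ruin and independence every renewal has the same probability
U, the infinite product of the (1 - ρ^j)^n over j ≥ 1.

Upper bound. Let v be the law of the first renewal and u_N the product of the first N factors.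
Splitting a renewal at k by the first renewal gives ∑_{j ≤ k} v_j u_{k-j} = U
(`sum_measureReal_firstStays_mul`). Differencing shows that v is the law of a geometric sum with
step weights u_i - u_{i+1} of total mass 1 - U. It has exponential moments up to a rate of order
(1-ρ)U/n, so the m-th moment is at most C/((1-ρ)U)^m (`moment_le`). Up to a constant factor, 1/U is
at most (1-ρ)^{n/2} exp(π²n/(6(1-ρ))) (`one_div_renewalProb_le`). The rate in (a) dominates the
result, since Z_ρ(1-ρ) → ∞ absorbs all constants.

Lower bound. By a union bound the first renewal is at least k with probability at least 1/2 as soon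
as kU ≤ 1/2 (`le_moment`). A crude exponential bound on U suffices, because (1-ρ)^{-δ} is eventually
at most (1-ρ)^{-1/2}, far below 1/(1-ρ).

Both comparisons hold near 1. Taking the maximum, respectively minimum, of moment and rate extends
them to all ρ without changing the asymptotics. -/

namespace FrogModel

/-! ### Renewal sequences -/

section Renewal

variable {v u : ℕ → ℝ} {U : ℝ}

/-- The identities `hconv` at `k` and `k + 1` are subtracted; the outcome is a renewal equation with
step weights `u i - u (i + 1)`. -/
lemma renewal_succ (hu0 : u 0 = 1)
    (hconv : ∀ k, ∑ j ∈ Finset.range (k + 1), v j * u (k - j) = U) (k : ℕ) :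
    v (k + 1) = ∑ j ∈ Finset.range (k + 1), v j * (u (k - j) - u (k - j + 1)) := by
  have h1 := hconv (k + 1)
  rw [Finset.sum_range_succ, Nat.sub_self, hu0, mul_one] at h1
  have h2 : ∑ j ∈ Finset.range (k + 1), v j * u (k + 1 - j)
      = ∑ j ∈ Finset.range (k + 1), v j * u (k - j + 1) := by
    refine Finset.sum_congr rfl fun j hj => ?_
    rw [Nat.sub_add_comm (Nat.lt_succ_iff.1 (Finset.mem_range.1 hj))]
  simp only [mul_sub, Finset.sum_sub_distrib]
  rw [hconv k, ← h2]
  linarith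

lemma sum_convolution_le {f g : ℕ → ℝ} (hf : ∀ k, 0 ≤ f k) (hg : ∀ k, 0 ≤ g k) (K : ℕ) :
    ∑ k ∈ Finset.range K, ∑ j ∈ Finset.range (k + 1), f j * g (k - j)
      ≤ (∑ j ∈ Finset.range K, f j) * ∑ i ∈ Finset.range K, g i := by
  rw [Finset.sum_range_diag_flip K fun a b => f a * g b, Finset.sum_mul_sum]
  refine Finset.sum_le_sum fun j _ => ?_
  exact Finset.sum_le_sum_of_subset_of_nonneg
    (Finset.range_subset_range.2 (Nat.sub_le _ _)) fun i _ _ => mul_nonneg (hf j) (hg i)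

/-- A renewal sequence has exponential moments as soon as the increments of the potential do. -/
lemma sum_renewal_mul_pow_le_two (hv : ∀ k, 0 ≤ v k) (hu : Antitone u) (hu0 : u 0 = 1)
    (hconv : ∀ k, ∑ j ∈ Finset.range (k + 1), v j * u (k - j) = U)
    {z : ℝ} (hz : 0 ≤ z)
    (hD : ∀ K, ∑ i ∈ Finset.range K, (u i - u (i + 1)) * z ^ (i + 1) ≤ 1 - U / 2) (K : ℕ) :
    ∑ k ∈ Finset.range K, v k * z ^ k ≤ 2 := by
  have hd : ∀ i, 0 ≤ u i - u (i + 1) := fun i => sub_nonneg.2 (hu (Nat.le_succ i))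
  have hv0 : v 0 = U := by simpa [hu0] using hconv 0
  -- If S_K is the partial sum, the renewal equation gives S_{K+1} ≤ U + S_K (1 - U/2), and 2 is the
  -- fixed point of this map. Working with partial sums presupposes no convergence.
  induction K with
  | zero => simp
  | succ K ih =>
    rw [Finset.sum_range_succ', pow_zero, mul_one, hv0]
    have h1 : ∑ k ∈ Finset.range K, v (k + 1) * z ^ (k + 1)
        = ∑ k ∈ Finset.range K, ∑ j ∈ Finset.range (k + 1),
          (v j * z ^ j) * ((u (k - j) - u (k - j + 1)) * z ^ (k - j + 1)) := by
      refine Finset.sum_congr rfl fun k _ => ?_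
      rw [renewal_succ hu0 hconv, Finset.sum_mul]
      refine Finset.sum_congr rfl fun j hj => ?_
      have : z ^ (k + 1) = z ^ j * z ^ (k - j + 1) := by
        rw [← pow_add]
        congr 1
        have := Finset.mem_range.1 hj
        omega
      rw [this]
      ring
    have h2 := sum_convolution_le (f := fun j => v j * z ^ j)
      (g := fun i => (u i - u (i + 1)) * z ^ (i + 1))
      (fun k => mul_nonneg (hv k) (pow_nonneg hz k))
      (fun k => mul_nonneg (hd k) (pow_nonneg hz _)) K
    have h3 : 0 ≤ ∑ i ∈ Finset.range K, (u i - u (i + 1)) * z ^ (i + 1) :=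
      Finset.sum_nonneg fun i _ => mul_nonneg (hd i) (pow_nonneg hz _)
    have h4 := hD K
    rw [h1]
    nlinarith [mul_le_mul_of_nonneg_right ih h3]

/-- A renewal sequence with summable delay and positive limit of the potential is proper. -/
lemma tsum_renewal_eq_one (hv : ∀ k, 0 ≤ v k) (hsum : Summable v)
    (hub : ∀ k, |u k| ≤ 1) (hlim : Tendsto u atTop (𝓝 U)) (hU : U ≠ 0)
    (hconv : ∀ k, ∑ j ∈ Finset.range (k + 1), v j * u (k - j) = U) :
    ∑' k, v k = 1 := by
  -- As k → ∞, `hconv` becomes (∑ v) U = U.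
  have h := tendsto_tsum_of_dominated_convergence (𝓕 := atTop)
    (f := fun k j => if j < k + 1 then v j * u (k - j) else 0)
    (g := fun j => v j * U) (bound := v) hsum
    (fun j => by
      have h1 : Tendsto (fun k => v j * u (k - j)) atTop (𝓝 (v j * U)) :=
        (hlim.comp (tendsto_sub_atTop_nat j)).const_mul _
      refine h1.congr' ?_
      filter_upwards [eventually_ge_atTop j] with k hk
      rw [if_pos (Nat.lt_succ_of_le hk)])
    (Eventually.of_forall fun k j => by
      split_ifs
      · rw [Real.norm_eq_abs, abs_mul, abs_of_nonneg (hv j)]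
        exact mul_le_of_le_one_right (hv j) (hub _)
      · simpa using hv j)
  have h2 : ∀ k, ∑' j, (if j < k + 1 then v j * u (k - j) else 0) = U := by
    intro k
    rw [tsum_eq_sum (s := Finset.range (k + 1))
      (fun j hj => if_neg (by simpa using hj)), ← hconv k]
    exact Finset.sum_congr rfl fun j hj => if_pos (Finset.mem_range.1 hj)
  simp only [h2] at h
  have h3 := tendsto_nhds_unique h tendsto_const_nhds
  rw [tsum_mul_right] at h3
  exact mul_right_cancel₀ hU (by rw [h3, one_mul])

end Renewal

/-! ### The product `∏ (1 - ρ ^ j)` -/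

/-- The quotient is 1/((1+σ)^k - 1). The linear term of the binomial expansion gives the first
bound; the quadratic term gives the correction -1/2, which produces the power of 1-ρ in the Euler
function. -/
lemma pow_div_one_sub_pow_le {ρ σ : ℝ} (hσ : 0 < σ) (hρ : ρ = 1 / (1 + σ)) {k : ℕ} (hk : 1 ≤ k) :
    ρ ^ k / (1 - ρ ^ k) ≤ 1 / (σ * k) ∧
      ρ ^ k / (1 - ρ ^ k) ≤ 1 / (σ * k) - 1 / 2 + 1 / (2 * k) + k * σ / 4 := by
  have hquad : ∀ k : ℕ, 1 + k * σ + k * (k - 1) / 2 * σ ^ 2 ≤ (1 + σ) ^ k := by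
    intro k
    induction k with
    | zero => simp
    | succ k ih =>
      rw [pow_succ (1 + σ) k]
      push_cast
      have h : (0 : ℝ) ≤ k * (k - 1) / 2 * σ ^ 3 := by
        rcases Nat.eq_zero_or_pos k with rfl | hk
        · simp
        · have : (1 : ℝ) ≤ k := by exact_mod_cast hk
          have : (0 : ℝ) ≤ k - 1 := by linarith
          positivity
      nlinarith [mul_le_mul_of_nonneg_right ih (by linarith : (0 : ℝ) ≤ 1 + σ)]
  have hk1 : (1 : ℝ) ≤ k := by exact_mod_cast hk
  have hpow : (1 : ℝ) < (1 + σ) ^ k := one_lt_pow₀ (by linarith) (by omega)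
  have heq : ρ ^ k / (1 - ρ ^ k) = 1 / ((1 + σ) ^ k - 1) := by
    rw [hρ, div_pow, one_pow]
    have h1 : (1 + σ) ^ k ≠ 0 := by positivity
    have h2 : (1 + σ) ^ k - 1 ≠ 0 := by linarith
    have h3 : 1 - 1 / (1 + σ) ^ k ≠ 0 := by
      rw [one_sub_div h1]
      exact div_ne_zero h2 h1
    field_simp
  have hA : (0 : ℝ) < σ * k := by positivity
  set x : ℝ := (k - 1) * σ / 2 with hx
  have hx0 : 0 ≤ x := by
    have : (0 : ℝ) ≤ k - 1 := by linarith
    positivity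
  have hlow : σ * k * (1 + x) ≤ (1 + σ) ^ k - 1 := by
    have := hquad k
    rw [hx]
    nlinarith
  rw [heq]
  constructor
  · refine one_div_le_one_div_of_le hA (le_trans ?_ hlow)
    nlinarith
  · refine (one_div_le_one_div_of_le (by positivity) hlow).trans ?_
    have h1 : 1 / (1 + x) ≤ 1 - x + x ^ 2 := by
      rw [div_le_iff₀ (by linarith)]
      nlinarith [pow_nonneg hx0 3]
    calc 1 / (σ * k * (1 + x)) = 1 / (σ * k) * (1 / (1 + x)) := by field_simp
      _ ≤ 1 / (σ * k) * (1 - x + x ^ 2) := by gcongr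
      _ = 1 / (σ * k) - 1 / 2 + 1 / (2 * k) + (k - 1) ^ 2 / k * σ / 4 := by
        rw [hx]
        field_simp
        ring
      _ ≤ _ := by
        gcongr
        rw [div_le_iff₀ (by linarith)]
        nlinarith

/-- Expand the logarithms and sum over `j` first: what remains is at most ∑_k ρ^k / (k (1-ρ^k)). The
main terms 1/(σk²) add up to π²/(6σ). The refined bound is used only for k ≤ K, where the terms
-1/(2k) yield -log(K+1)/2, while its error terms σ/4 would diverge over all k. -/
lemma neg_log_prod_le {ρ σ : ℝ} (hσ : 0 < σ) (hρ : ρ = 1 / (1 + σ)) (N K : ℕ) :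
    -Real.log (∏ j ∈ Finset.range N, (1 - ρ ^ (j + 1)))
      ≤ 1 / σ * (Real.pi ^ 2 / 6) - Real.log (K + 1) / 2 + Real.pi ^ 2 / 12 + K * σ / 4 := by
  have hρ0 : 0 < ρ := by rw [hρ]; positivity
  have hρ1 : ρ < 1 := by rw [hρ, div_lt_one (by linarith)]; linarith
  have hpow1 : ∀ j : ℕ, ρ ^ (j + 1) < 1 := fun j => pow_lt_one₀ hρ0.le hρ1 (by omega)
  have hpow0 : ∀ j : ℕ, 0 < ρ ^ j := fun j => pow_pos hρ0 j
  rw [Real.log_prod (fun j _ => by linarith [hpow1 j]), ← Finset.sum_neg_distrib]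
  have hsum := hasSum_sum (s := Finset.range N) fun j _ =>
    Real.hasSum_pow_div_log_of_abs_lt_one
      (x := ρ ^ (j + 1)) (by rw [abs_of_pos (hpow0 _)]; exact hpow1 j)
  have hz : HasSum (fun k : ℕ => 1 / σ * (1 / ((k : ℝ) + 1) ^ 2)) (1 / σ * (Real.pi ^ 2 / 6)) := by
    have := (hasSum_nat_add_iff' 1).2 hasSum_zeta_two
    simp only [Finset.range_one, Finset.sum_singleton, Nat.cast_zero, Nat.cast_add,
      Nat.cast_one] at this
    have h2 := this.mul_left (1 / σ)
    simpa using h2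
  set c : ℕ → ℝ := fun k => -(1 / 2) * (1 / ((k : ℝ) + 1)) + 1 / 2 * (1 / ((k : ℝ) + 1) ^ 2) + σ / 4
    with hc
  have hfin : HasSum (fun k : ℕ => if k ∈ Finset.range K then c k else 0)
      (∑ k ∈ Finset.range K, c k) := by
    rw [← Finset.sum_congr rfl fun k hk => if_pos (c := k ∈ Finset.range K) hk (e := (0 : ℝ))]
    exact hasSum_sum_of_ne_finset_zero fun k hk => if_neg hk
  have hle := hasSum_le (fun k => ?_) hsum (hz.add hfin)
  · refine hle.trans ?_
    have hcs : ∑ k ∈ Finset.range K, c k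
        = -(1 / 2) * (∑ k ∈ Finset.range K, 1 / ((k : ℝ) + 1))
          + 1 / 2 * (∑ k ∈ Finset.range K, 1 / ((k : ℝ) + 1) ^ 2) + K * σ / 4 := by
      rw [hc, Finset.sum_add_distrib, Finset.sum_add_distrib, ← Finset.mul_sum, ← Finset.mul_sum]
      simp
      ring
    have hharm : Real.log (K + 1) ≤ ∑ k ∈ Finset.range K, 1 / ((k : ℝ) + 1) := by
      have := log_add_one_le_harmonic K
      simp only [harmonic, Rat.cast_sum] at this
      push_cast at this
      simpa using this
    have hz2 : ∑ k ∈ Finset.range K, 1 / ((k : ℝ) + 1) ^ 2 ≤ Real.pi ^ 2 / 6 := by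
      have h1 := hz.mul_left σ
      have h2 : HasSum (fun k : ℕ => 1 / ((k : ℝ) + 1) ^ 2) (Real.pi ^ 2 / 6) := by
        simpa only [← mul_assoc, mul_one_div_cancel hσ.ne', one_mul] using h1
      exact sum_le_hasSum _ (fun k _ => by positivity) h2
    rw [hcs]
    linarith
  · have hx1 : ρ ^ (k + 1) < 1 := hpow1 k
    have hgeom : ∑ j ∈ Finset.range N, (ρ ^ (k + 1)) ^ (j + 1) ≤ ρ ^ (k + 1) / (1 - ρ ^ (k + 1)) := by
      have h := (hasSum_geometric_of_lt_one (hpow0 (k + 1)).le hx1).mul_left (ρ ^ (k + 1))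
      have h2 := sum_le_hasSum (Finset.range N) (fun j _ => by positivity) h
      simpa only [pow_succ', div_eq_mul_inv] using h2
    have hk0 : (0 : ℝ) < (k : ℝ) + 1 := by positivity
    have heq : ∑ j ∈ Finset.range N, (ρ ^ (j + 1)) ^ (k + 1) / ((k : ℝ) + 1)
        = (∑ j ∈ Finset.range N, (ρ ^ (k + 1)) ^ (j + 1)) / ((k : ℝ) + 1) := by
      rw [Finset.sum_div]
      refine Finset.sum_congr rfl fun j _ => ?_
      rw [← pow_mul, ← pow_mul, mul_comm]
    rw [heq, div_le_iff₀ hk0]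
    refine hgeom.trans ?_
    obtain ⟨h1, h2⟩ := pow_div_one_sub_pow_le hσ hρ (k := k + 1) (by omega)
    push_cast at h1 h2
    split_ifs
    · refine h2.trans (le_of_eq ?_)
      rw [hc]
      field_simp
      ring
    · refine h1.trans (le_of_eq ?_)
      field_simp
      ring

/-- A lower bound for the Euler function which is sharp up to a constant factor. -/
lemma exists_le_prod_one_sub_pow :
    ∃ c : ℝ, 0 < c ∧ ∀ s : ℝ, 0 < s → s ≤ 1 / 2 → ∀ N : ℕ,
      c * (s ^ (-(1 / 2) : ℝ) * Real.exp (-(Real.pi ^ 2 / 6 / s)))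
        ≤ ∏ j ∈ Finset.range N, (1 - (1 - s) ^ (j + 1)) := by
  refine ⟨Real.exp (-(1 / 2)), Real.exp_pos _, fun s hs hs2 N => ?_⟩
  have h1s : 0 < 1 - s := by linarith
  have hσ : 0 < s / (1 - s) := div_pos hs h1s
  have hρ : 1 - s = 1 / (1 + s / (1 - s)) := by field_simp; ring
  have hprod : 0 < ∏ j ∈ Finset.range N, (1 - (1 - s) ^ (j + 1)) :=
    Finset.prod_pos fun j _ => sub_pos.2 (pow_lt_one₀ h1s.le (by linarith) (by omega))
  -- This cutoff extracts log(1/s)/2 and keeps the error Kσ/4 below 1/2, whence the constant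
  -- exp(-1/2).
  have h := neg_log_prod_le hσ hρ N ⌊1 / s⌋₊
  have hK1 : Real.log (1 / s) ≤ Real.log ((⌊1 / s⌋₊ : ℝ) + 1) :=
    Real.log_le_log (by positivity) (Nat.lt_floor_add_one _).le
  have hK2 : (⌊1 / s⌋₊ : ℝ) * (s / (1 - s)) ≤ 2 := by
    calc (⌊1 / s⌋₊ : ℝ) * (s / (1 - s)) ≤ 1 / s * (s / (1 - s)) := by
          gcongr
          exact Nat.floor_le (by positivity)
      _ = 1 / (1 - s) := by field_simp
      _ ≤ 2 := by rw [div_le_iff₀ h1s]; linarith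
  have hσ' : 1 / (s / (1 - s)) * (Real.pi ^ 2 / 6) = Real.pi ^ 2 / 6 / s - Real.pi ^ 2 / 6 := by
    field_simp
  rw [Real.rpow_def_of_pos hs, ← Real.exp_add, ← Real.exp_add, ← Real.le_log_iff_exp_le hprod]
  rw [one_div, Real.log_inv] at hK1
  rw [hσ'] at h
  have hpi : 0 ≤ Real.pi ^ 2 / 12 := by positivity
  have hpi' : Real.pi ^ 2 / 12 = Real.pi ^ 2 / 6 / 2 := by ring
  simp only [one_div] at h hK2 ⊢
  linarith

lemma one_sub_one_sub_pow_le {x : ℝ} (hx1 : x ≤ 1) (n : ℕ) :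
    1 - (1 - x) ^ n ≤ n * x := by
  have := one_add_mul_le_pow (a := -x) (by linarith) n
  rw [← sub_eq_add_neg] at this
  linarith

/-! ### The potential of the renewal process -/

/-- The probability that none of the frogs of the `N` sites `0, …, N - 1` ever visits `-1`. -/
noncomputable def potential (n : ℕ) (ρ : ℝ) (N : ℕ) : ℝ :=
  ∏ j ∈ Finset.range N, (1 - ρ ^ (j + 1)) ^ n

section Potential

variable {n : ℕ} {ρ : ℝ}

lemma potential_zero : potential n ρ 0 = 1 := by simp [potential]

lemma potential_succ (N : ℕ) :
    potential n ρ (N + 1) = potential n ρ N * (1 - ρ ^ (N + 1)) ^ n := by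
  simp [potential, Finset.prod_range_succ]

lemma one_sub_pow_mem (hρ : ρ ∈ Set.Ioo (0 : ℝ) 1) (j : ℕ) :
    1 - ρ ^ (j + 1) ∈ Set.Ioo (0 : ℝ) 1 :=
  ⟨sub_pos.2 (pow_lt_one₀ hρ.1.le hρ.2 (by omega)), sub_lt_self _ (pow_pos hρ.1 _)⟩

lemma potential_pos (hρ : ρ ∈ Set.Ioo (0 : ℝ) 1) (N : ℕ) : 0 < potential n ρ N :=
  Finset.prod_pos fun j _ => pow_pos (one_sub_pow_mem hρ j).1 n

lemma potential_antitone (hρ : ρ ∈ Set.Ioo (0 : ℝ) 1) : Antitone (potential n ρ) :=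
  antitone_nat_of_succ_le fun N => by
    rw [potential_succ]
    exact mul_le_of_le_one_right (potential_pos hρ N).le
      (pow_le_one₀ (one_sub_pow_mem hρ N).1.le (one_sub_pow_mem hρ N).2.le)

lemma potential_le_one (hρ : ρ ∈ Set.Ioo (0 : ℝ) 1) (N : ℕ) : potential n ρ N ≤ 1 := by
  simpa [potential_zero] using potential_antitone (n := n) hρ (Nat.zero_le N)

/-- For i ≥ 1 the product already contains the factor (1-ρ)^n ≤ 1-ρ. This gain keeps the mean step
of order 1/(1-ρ); without it the moment bound would lose a factor (1-ρ)^{-m}. -/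
lemma potential_sub_succ_le (hn : 1 ≤ n) (hρ : ρ ∈ Set.Ioo (0 : ℝ) 1) (i : ℕ) :
    potential n ρ i - potential n ρ (i + 1)
      ≤ (if i = 0 then 1 else 0) + n * (1 - ρ) * ρ ^ (i + 1) := by
  have h0 : 0 ≤ (n : ℝ) * (1 - ρ) * ρ ^ (i + 1) :=
    mul_nonneg (mul_nonneg (Nat.cast_nonneg _) (by linarith [hρ.2])) (pow_pos hρ.1 _).le
  split_ifs with hi
  · linarith [potential_le_one (n := n) hρ i, potential_pos (n := n) hρ (i + 1)]
  · have h1 : potential n ρ i ≤ 1 - ρ := by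
      refine (potential_antitone hρ (Nat.one_le_iff_ne_zero.2 hi)).trans ?_
      rw [potential_succ, potential_zero, one_mul, zero_add, pow_one]
      exact pow_le_of_le_one (by linarith [hρ.2]) (by linarith [hρ.1]) (by omega)
    have h2 := one_sub_one_sub_pow_le
      (pow_le_one₀ (n := i + 1) hρ.1.le hρ.2.le) n
    have h3 : 0 ≤ 1 - (1 - ρ ^ (i + 1)) ^ n :=
      sub_nonneg.2 (pow_le_one₀ (one_sub_pow_mem hρ i).1.le (one_sub_pow_mem hρ i).2.le)
    rw [potential_succ, zero_add]
    calc _ = potential n ρ i * (1 - (1 - ρ ^ (i + 1)) ^ n) := by ring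
      _ ≤ (1 - ρ) * (n * ρ ^ (i + 1)) := by
        exact mul_le_mul h1 h2 h3 (by linarith [hρ.2])
      _ = _ := by ring

lemma sum_pow_mul_sub_one_le (hρ : ρ ∈ Set.Ioo (0 : ℝ) 1) {ε : ℝ} (hε : 0 ≤ ε)
    (hε2 : ε ≤ (1 - ρ) / 2) (K : ℕ) :
    ∑ i ∈ Finset.range K, ρ ^ (i + 1) * ((1 + ε) ^ (i + 1) - 1) ≤ 2 * ε / (1 - ρ) ^ 2 := by
  obtain ⟨h0, h1⟩ := hρ
  have h1ρ : 0 < 1 - ρ := by linarith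
  have hz : (1 - ρ) / 2 ≤ 1 - ρ * (1 + ε) := by nlinarith
  have hz0 : 0 ≤ ρ * (1 + ε) := by positivity
  have hA := (hasSum_geometric_of_lt_one hz0 (by linarith)).mul_left (ρ * (1 + ε))
  have hB := (hasSum_geometric_of_lt_one h0.le h1).mul_left ρ
  have hC := hA.sub hB
  have hnn : ∀ i : ℕ, 0 ≤ ρ ^ (i + 1) * ((1 + ε) ^ (i + 1) - 1) := fun i =>
    mul_nonneg (by positivity) (sub_nonneg.2 (one_le_pow₀ (by linarith)))
  have hterm : ∀ i : ℕ, ρ * (1 + ε) * (ρ * (1 + ε)) ^ i - ρ * ρ ^ i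
      = ρ ^ (i + 1) * ((1 + ε) ^ (i + 1) - 1) := fun i => by
    rw [mul_pow]
    ring
  simp only [hterm] at hC
  refine (sum_le_hasSum _ (fun i _ => hnn i) hC).trans ?_
  have hz1 : 0 < 1 - ρ * (1 + ε) := by linarith
  have heq : ρ * (1 + ε) * (1 - ρ * (1 + ε))⁻¹ - ρ * (1 - ρ)⁻¹
      = ρ * ε / ((1 - ρ * (1 + ε)) * (1 - ρ)) := by
    field_simp
    ring
  rw [heq, div_le_div_iff₀ (by positivity) (by positivity)]
  have h : ρ * (1 - ρ) ≤ 2 * (1 - ρ * (1 + ε)) := by nlinarith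
  nlinarith [mul_le_mul_of_nonneg_right h (mul_nonneg hε h1ρ.le)]

/-- The mass telescopes to at most 1 - U, and the exponential weight adds at most ε + 2nε/(1-ρ) = ε
+ U/3. With ε ≤ U/6 this is at most U/2, which explains the 6. -/
lemma sum_potential_sub_mul_pow_le (hn : 1 ≤ n) (hρ : ρ ∈ Set.Ioo (0 : ℝ) 1) {U : ℝ}
    (hU0 : 0 ≤ U) (hU : ∀ N, U ≤ potential n ρ N) (K : ℕ) :
    ∑ i ∈ Finset.range K, (potential n ρ i - potential n ρ (i + 1)) *
      (1 + (1 - ρ) * U / (6 * n)) ^ (i + 1) ≤ 1 - U / 2 := by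
  have hn' : (1 : ℝ) ≤ n := by exact_mod_cast hn
  have h1ρ : 0 < 1 - ρ := by linarith [hρ.2]
  have hU1 : U ≤ 1 := by simpa [potential_zero] using hU 0
  set ε : ℝ := (1 - ρ) * U / (6 * n) with hεdef
  have hε : 0 ≤ ε := by positivity
  have hεn : ε * (6 * n) = (1 - ρ) * U := by
    rw [hεdef]
    field_simp
  have hε2 : ε ≤ (1 - ρ) / 2 := by
    have : (1 - ρ) * U ≤ 1 - ρ := mul_le_of_le_one_right h1ρ.le hU1
    nlinarith
  have hz1 : ∀ i : ℕ, 0 ≤ (1 + ε) ^ (i + 1) - 1 := fun i =>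
    sub_nonneg.2 (one_le_pow₀ (by linarith))
  have htel : ∑ i ∈ Finset.range K, (potential n ρ i - potential n ρ (i + 1)) ≤ 1 - U := by
    rw [Finset.sum_range_sub', potential_zero]
    linarith [hU K]
  have hsplit : ∑ i ∈ Finset.range K, (potential n ρ i - potential n ρ (i + 1)) *
        (1 + ε) ^ (i + 1)
      = ∑ i ∈ Finset.range K, (potential n ρ i - potential n ρ (i + 1))
        + ∑ i ∈ Finset.range K, (potential n ρ i - potential n ρ (i + 1)) *
          ((1 + ε) ^ (i + 1) - 1) := by
    rw [← Finset.sum_add_distrib]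
    exact Finset.sum_congr rfl fun i _ => by ring
  have hexc : ∑ i ∈ Finset.range K, (potential n ρ i - potential n ρ (i + 1)) *
        ((1 + ε) ^ (i + 1) - 1)
      ≤ ε + n * (1 - ρ) * (2 * ε / (1 - ρ) ^ 2) := by
    calc _ ≤ ∑ i ∈ Finset.range K, ((if i = 0 then ε else 0)
            + n * (1 - ρ) * (ρ ^ (i + 1) * ((1 + ε) ^ (i + 1) - 1))) := by
          refine Finset.sum_le_sum fun i _ => ?_
          refine (mul_le_mul_of_nonneg_right (potential_sub_succ_le hn hρ i) (hz1 i)).trans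
            (le_of_eq ?_)
          rw [add_mul]
          congr 1
          · split_ifs with hi
            · subst hi
              ring
            · ring
          · ring
      _ ≤ _ := by
          rw [Finset.sum_add_distrib, ← Finset.mul_sum]
          gcongr
          · rw [Finset.sum_ite_eq']
            split_ifs
            · exact le_rfl
            · exact hε
          · exact sum_pow_mul_sub_one_le hρ hε hε2 K
  have hfin : ε + n * (1 - ρ) * (2 * ε / (1 - ρ) ^ 2) ≤ U / 2 := by
    have h : n * (1 - ρ) * (2 * ε / (1 - ρ) ^ 2) = U / 3 := by
      rw [hεdef]
      field_simp
      ring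
    rw [h]
    have : (1 - ρ) * U ≤ U := mul_le_of_le_one_left hU0 (by linarith [hρ.1])
    nlinarith
  rw [hsplit]
  linarith

end Potential

/-- One term of the exponential series at εk/2, combined with e^{ε/2} ≤ 1 + ε. -/
lemma nat_pow_le_mul_one_add_pow {ε : ℝ} (hε : 0 < ε) (hε1 : ε ≤ 1) (k m : ℕ) :
    (k : ℝ) ^ m ≤ m.factorial * (2 / ε) ^ m * (1 + ε) ^ k := by
  have h1 := Real.pow_div_factorial_le_exp (x := ε / 2 * k) (by positivity) m
  have h2 : Real.exp (ε / 2 * k) ≤ (1 + ε) ^ k := by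
    rw [mul_comm, Real.exp_nat_mul]
    gcongr
    have h3 := Real.add_one_le_exp (-(ε / 2))
    have h4 : Real.exp (ε / 2) * Real.exp (-(ε / 2)) = 1 := by
      rw [← Real.exp_add]
      simp
    nlinarith [Real.exp_pos (ε / 2)]
  have h3 := h1.trans h2
  rw [div_le_iff₀ (by positivity), mul_pow] at h3
  calc (k : ℝ) ^ m = (2 / ε) ^ m * ((ε / 2) ^ m * k ^ m) := by
        rw [← mul_assoc, ← mul_pow, div_mul_div_comm, mul_comm 2 ε,
          div_self (by positivity), one_pow, one_mul]
      _ ≤ (2 / ε) ^ m * ((1 + ε) ^ k * m.factorial) := by gcongr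
      _ = _ := by ring

open ProbabilityTheory

/-! ### Independence of the steps -/

instance (ρ : Set.Ioo (0 : ℝ) 1) : IsProbabilityMeasure (law ρ) := by
  unfold law
  infer_instance

/-- The σ-algebra generated by the steps with index in `S`. -/
@[reducible]
def stepAlgebra (S : Set (ℤ × ℕ × ℕ)) : MeasurableSpace Sample :=
  ⨆ c ∈ S, MeasurableSpace.comap (fun ω : Sample => ω c) inferInstance

lemma stepAlgebra_le (S : Set (ℤ × ℕ × ℕ)) : stepAlgebra S ≤ MeasurableSpace.pi :=
  iSup₂_le fun c _ => (measurable_pi_apply c).comap_le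

lemma measurable_step {S : Set (ℤ × ℕ × ℕ)} {c : ℤ × ℕ × ℕ} (hc : c ∈ S) :
    Measurable[stepAlgebra S] fun ω : Sample => ω c :=
  Measurable.of_comap_le
    (le_iSup₂ (f := fun c (_ : c ∈ S) =>
      MeasurableSpace.comap (fun ω : Sample => ω c) inferInstance) c hc)

lemma measurable_sum_step {S : Set (ℤ × ℕ × ℕ)} {x : ℤ} {i a : ℕ}
    (h : ∀ l, (x, i, a + l) ∈ S) (k : ℕ) :
    Measurable[stepAlgebra S] fun ω : Sample => ∑ l ∈ Finset.range k, ω (x, i, a + l) :=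
  @Finset.measurable_sum _ _ _ _ _ _ (stepAlgebra S) _ _ fun l _ => measurable_step (h l)

lemma iIndepFun_step (ρ : Set.Ioo (0 : ℝ) 1) :
    iIndepFun (fun (c : ℤ × ℕ × ℕ) (ω : Sample) => ω c) (law ρ) :=
  iIndepFun_infinitePi (X := fun _ => id) fun _ => measurable_id

lemma measureReal_inter_of_disjoint (ρ : Set.Ioo (0 : ℝ) 1) {S T : Set (ℤ × ℕ × ℕ)}
    (hST : Disjoint S T) {A B : Set Sample} (hA : MeasurableSet[stepAlgebra S] A)
    (hB : MeasurableSet[stepAlgebra T] B) :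
    (law ρ).real (A ∩ B) = (law ρ).real A * (law ρ).real B := by
  have h := indep_iSup_of_disjoint (fun c => (measurable_pi_apply c).comap_le)
    (iIndepFun_step ρ) hST
  rw [measureReal_def, (Indep_iff _ _ _).1 h A B hA hB, ENNReal.toReal_mul]
  rfl

lemma map_step (ρ : Set.Ioo (0 : ℝ) 1) (c : ℤ × ℕ × ℕ) :
    (law ρ).map (fun ω => ω c) = stepLaw ρ :=
  Measure.infinitePi_map_eval _ c

lemma rightProb_mem (ρ : Set.Ioo (0 : ℝ) 1) : rightProb ρ ∈ Set.Ioo (1 / 2 : ℝ) 1 := by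
  obtain ⟨r, h0, h1⟩ := ρ
  simp only [rightProb, Set.mem_Ioo]
  constructor
  · exact one_div_lt_one_div_of_lt (by linarith) (by linarith)
  · rw [div_lt_one (by linarith)]
    linarith

lemma measureReal_step_eq (ρ : Set.Ioo (0 : ℝ) 1) (c : ℤ × ℕ × ℕ) (e : ℤ) :
    (law ρ).real {ω | ω c = e}
      = if e = 1 then rightProb ρ else if e = -1 then 1 - rightProb ρ else 0 := by
  have h := rightProb_mem ρ
  have h1 : law ρ {ω | ω c = e} = stepLaw ρ {e} := by
    rw [← map_step ρ c, Measure.map_apply (measurable_pi_apply c) (measurableSet_singleton e)]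
    rfl
  rw [measureReal_def, h1]
  simp only [stepLaw, Measure.coe_add, Measure.coe_smul, Pi.add_apply, Pi.smul_apply,
    Measure.dirac_apply, smul_eq_mul]
  by_cases he : e = 1
  · subst he
    simp [ENNReal.toReal_ofReal (by linarith [h.1] : 0 ≤ rightProb ρ)]
  · by_cases he' : e = -1
    · subst he'
      simp [ENNReal.toReal_ofReal (by linarith [h.2] : 0 ≤ 1 - rightProb ρ)]
    · simp [he, he', Ne.symm he, Ne.symm he']

lemma ae_step (ρ : Set.Ioo (0 : ℝ) 1) : ∀ᵐ ω ∂law ρ, ∀ c, ω c = 1 ∨ ω c = -1 := by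
  rw [ae_all_iff]
  intro c
  have h : ∀ᵐ e ∂stepLaw ρ, e = 1 ∨ e = -1 := by
    simp [stepLaw, ae_iff]
  rw [← map_step ρ c] at h
  exact ae_of_ae_map (measurable_pi_apply c).aemeasurable h

/-! ### Hitting probabilities to the left -/

/-- The walk that uses the steps of the frog `i` of the site `x` from number `a` on reaches
`-j` or a point to the left of it within `t` steps. -/
def leftHit (x : ℤ) (i a t : ℕ) (j : ℕ) : Set Sample :=
  {ω | ∃ k ≤ t, ∑ l ∈ Finset.range k, ω (x, i, a + l) ≤ -(j : ℤ)}

lemma measurableSet_leftHit {S : Set (ℤ × ℕ × ℕ)} {x : ℤ} {i a : ℕ}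
    (h : ∀ l, (x, i, a + l) ∈ S) (t j : ℕ) :
    MeasurableSet[stepAlgebra S] (leftHit x i a t j) := by
  have : leftHit x i a t j = ⋃ k, ⋃ (_ : k ≤ t),
      (fun ω : Sample => ∑ l ∈ Finset.range k, ω (x, i, a + l)) ⁻¹' Set.Iic (-(j : ℤ)) := by
    ext ω
    simp [leftHit]
  rw [this]
  exact MeasurableSet.iUnion fun k => MeasurableSet.iUnion fun _ =>
    measurable_sum_step h k measurableSet_Iic

/-- The finite-horizon hitting probabilities of a walk. -/
noncomputable def leftHitProb (p : ℝ) : ℕ → ℕ → ℝ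
  | _, 0 => 1
  | 0, _ + 1 => 0
  | t + 1, j + 1 => p * leftHitProb p t (j + 2) + (1 - p) * leftHitProb p t j

lemma leftHit_succ_iff {ω : Sample} {x : ℤ} {i a t j : ℕ} :
    ω ∈ leftHit x i a (t + 1) (j + 1) ↔
      ∃ k ≤ t, ω (x, i, a) + ∑ l ∈ Finset.range k, ω (x, i, a + 1 + l) ≤ -((j : ℤ) + 1) := by
  have hsum : ∀ k, ∑ l ∈ Finset.range (k + 1), ω (x, i, a + l)
      = ω (x, i, a) + ∑ l ∈ Finset.range k, ω (x, i, a + 1 + l) := by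
    intro k
    rw [Finset.sum_range_succ', add_zero, add_comm]
    congr 1
    exact Finset.sum_congr rfl fun l _ => by rw [add_assoc, add_comm 1 l]
  constructor
  · rintro ⟨k, hk, h⟩
    rcases k with _ | k
    · simp at h
      omega
    · rw [hsum] at h
      exact ⟨k, by omega, by simpa using h⟩
  · rintro ⟨k, hk, h⟩
    exact ⟨k + 1, by omega, by rw [hsum]; simpa using h⟩

/-- First-step analysis. The offset `a` makes the walk after one step an event of the same kind, so
the induction runs over all `a` at once. -/
lemma measureReal_leftHit (ρ : Set.Ioo (0 : ℝ) 1) (x : ℤ) (i t j a : ℕ) :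
    (law ρ).real (leftHit x i a t j) = leftHitProb (rightProb ρ) t j := by
  induction t generalizing j a with
  | zero =>
    rcases j with _ | j
    · have : leftHit x i a 0 0 = Set.univ := by
        ext ω
        simp [leftHit]
      simp [this, leftHitProb]
    · have : leftHit x i a 0 (j + 1) = ∅ := by
        ext ω
        simp [leftHit]
        omega
      simp [this, leftHitProb]
  | succ t ih =>
    rcases j with _ | j
    · have : leftHit x i a (t + 1) 0 = Set.univ := by
        ext ω
        simp only [leftHit, Set.mem_ofPred_eq, Set.mem_univ, iff_true]
        exact ⟨0, by omega, by simp⟩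
      simp [this, leftHitProb]
    · set S : Set (ℤ × ℕ × ℕ) := {(x, i, a)}
      set T : Set (ℤ × ℕ × ℕ) := {c | ∃ l, c = (x, i, a + 1 + l)}
      have hST : Disjoint S T := by
        rw [Set.disjoint_singleton_left]
        rintro ⟨l, hl⟩
        simp at hl
        omega
      have hmem : ∀ l, (x, i, a + 1 + l) ∈ T := fun l => ⟨l, rfl⟩
      have hmT : ∀ j, MeasurableSet[stepAlgebra T] (leftHit x i (a + 1) t j) := fun j =>
        measurableSet_leftHit hmem t j
      have hmS : ∀ e : ℤ, MeasurableSet[stepAlgebra S] {ω : Sample | ω (x, i, a) = e} := fun e =>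
        measurable_step (S := S) rfl (measurableSet_singleton e)
      have hae : leftHit x i a (t + 1) (j + 1) =ᵐ[law ρ]
          (({ω | ω (x, i, a) = 1} ∩ leftHit x i (a + 1) t (j + 2)) ∪
            ({ω | ω (x, i, a) = -1} ∩ leftHit x i (a + 1) t j) : Set Sample) := by
        filter_upwards [ae_step ρ] with ω hω
        refine propext ?_
        change ω ∈ leftHit x i a (t + 1) (j + 1) ↔ _
        rw [leftHit_succ_iff]
        change _ ↔ (ω (x, i, a) = 1 ∧ ∃ k ≤ t, _) ∨ (ω (x, i, a) = -1 ∧ ∃ k ≤ t, _)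
        rcases hω (x, i, a) with h | h <;> rw [h] <;> simp only [true_and, false_and, or_false,
          false_or, reduceCtorEq, Nat.cast_add, Nat.cast_ofNat, Int.reduceNeg] <;>
          refine exists_congr fun k => and_congr_right fun _ => ?_ <;> constructor <;> intro h <;>
          linarith
      have hdisj : Disjoint ({ω | ω (x, i, a) = 1} ∩ leftHit x i (a + 1) t (j + 2))
          ({ω | ω (x, i, a) = -1} ∩ leftHit x i (a + 1) t j) := by
        rw [Set.disjoint_left]
        rintro ω ⟨h1, _⟩ ⟨h2, _⟩
        rw [Set.mem_ofPred_eq] at h1 h2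
        omega
      rw [measureReal_congr hae, measureReal_union hdisj
        ((stepAlgebra_le S _ (hmS (-1))).inter (stepAlgebra_le T _ (hmT j))),
        measureReal_inter_of_disjoint ρ hST (hmS 1) (hmT _),
        measureReal_inter_of_disjoint ρ hST (hmS (-1)) (hmT _), ih, ih,
        measureReal_step_eq, measureReal_step_eq]
      simp [leftHitProb]

lemma rightProb_mul (ρ : Set.Ioo (0 : ℝ) 1) : rightProb ρ * ρ = 1 - rightProb ρ := by
  have : (1 : ℝ) + ρ ≠ 0 := by linarith [ρ.2.1]
  unfold rightProb
  field_simp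
  ring

/-- The sequence ρ^j solves the recursion. The bound supplies the decay in `j` needed for uniqueness
in `eq_pow_of_harmonic`. -/
lemma leftHitProb_le (ρ : Set.Ioo (0 : ℝ) 1) (t j : ℕ) :
    leftHitProb (rightProb ρ) t j ≤ (ρ : ℝ) ^ j := by
  have hρ := ρ.2
  have hp := rightProb_mem ρ
  have hmul := rightProb_mul ρ
  induction t generalizing j with
  | zero =>
    rcases j with _ | j
    · simp [leftHitProb]
    · exact pow_nonneg hρ.1.le _
  | succ t ih =>
    rcases j with _ | j
    · simp [leftHitProb]
    · rw [leftHitProb]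
      have h1 := mul_le_mul_of_nonneg_left (ih (j + 2)) (by linarith [hp.1] : 0 ≤ rightProb ρ)
      have h2 := mul_le_mul_of_nonneg_left (ih j) (by linarith [hp.2] : 0 ≤ 1 - rightProb ρ)
      refine (add_le_add h1 h2).trans (le_of_eq ?_)
      rw [← hmul, pow_succ, pow_succ]
      have : rightProb ρ * (ρ : ℝ) + rightProb ρ = 1 := by linarith
      linear_combination (ρ : ℝ) ^ j * ρ * this

/-- The only solution of the recursion of the hitting probabilities that vanishes at infinity. -/
lemma eq_pow_of_harmonic (ρ : Set.Ioo (0 : ℝ) 1) {h : ℕ → ℝ} (h0 : h 0 = 1)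
    (hrec : ∀ j, h (j + 1) = rightProb ρ * h (j + 2) + (1 - rightProb ρ) * h j)
    (hlim : Tendsto h atTop (𝓝 0)) (j : ℕ) : h j = (ρ : ℝ) ^ j := by
  have hp : 0 < rightProb ρ := by linarith [(rightProb_mem ρ).1]
  have hmul := rightProb_mul ρ
  -- Since 1-p = pρ, this difference is conserved by the recursion; its limit is 0.
  have hconst : ∀ j, h (j + 1) - ρ * h j = h 1 - ρ * h 0 := by
    intro j
    induction j with
    | zero => rfl
    | succ j ih =>
      rw [← ih]
      have := hrec j
      refine mul_left_cancel₀ hp.ne' ?_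
      rw [← hmul] at this
      have h1 : rightProb ρ * (ρ : ℝ) + rightProb ρ = 1 := by linarith
      linear_combination -this + (h (j + 1)) * (-h1)
  have hzero : h 1 - ρ * h 0 = 0 := by
    have h1 : Tendsto (fun j => h (j + 1) - ρ * h j) atTop (𝓝 (0 - ρ * 0)) :=
      (hlim.comp (tendsto_add_atTop_nat 1)).sub (hlim.const_mul _)
    simp only [hconst] at h1
    simpa using tendsto_nhds_unique tendsto_const_nhds h1
  induction j with
  | zero => simpa using h0
  | succ j ih =>
    have := hconst j
    rw [hzero, ih] at this
    rw [pow_succ]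
    linarith

/-- The frog `i` of the site `x` never walks to the left of `y`. -/
def staysRight (y x : ℤ) (i : ℕ) : Set Sample := {ω | ∀ l, y ≤ position ω x i l}

lemma measurableSet_staysRight {S : Set (ℤ × ℕ × ℕ)} {x : ℤ} {i : ℕ}
    (h : ∀ l, (x, i, l) ∈ S) (y : ℤ) : MeasurableSet[stepAlgebra S] (staysRight y x i) := by
  have : staysRight y x i = ⋂ k,
      (fun ω : Sample => ∑ l ∈ Finset.range k, ω (x, i, 0 + l)) ⁻¹' Set.Ici (y - x) := by
    ext ω
    simp [staysRight, position, add_comm x]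
  rw [this]
  exact MeasurableSet.iInter fun k =>
    measurable_sum_step (fun l => by simpa using h l) k measurableSet_Ici

/-- Gambler's ruin. -/
lemma measureReal_staysRight (ρ : Set.Ioo (0 : ℝ) 1) (y : ℤ) (i j : ℕ) :
    (law ρ).real (staysRight y (y + j) i) = 1 - (ρ : ℝ) ^ (j + 1) := by
  set x : ℤ := y + j with hx
  have hcompl : ∀ j : ℕ, Tendsto (fun t => leftHitProb (rightProb ρ) t j) atTop
      (𝓝 ((law ρ).real (⋃ t, leftHit x i 0 t j))) := by
    intro j
    have hmono : Monotone fun t => leftHit x i 0 t j := by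
      rintro t t' htt ω ⟨k, hk, h⟩
      exact ⟨k, hk.trans htt, h⟩
    have h := tendsto_measure_iUnion_atTop (μ := law ρ) hmono
    have h2 := (ENNReal.tendsto_toReal (measure_ne_top _ _)).comp h
    refine h2.congr fun t => ?_
    exact measureReal_leftHit ρ x i t j 0
  have hpow := eq_pow_of_harmonic ρ (h := fun j => (law ρ).real (⋃ t, leftHit x i 0 t j))
    (tendsto_nhds_unique (hcompl 0) (by simp [leftHitProb]))
    (fun j => by
      refine tendsto_nhds_unique ((hcompl (j + 1)).comp (tendsto_add_atTop_nat 1)) ?_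
      exact ((hcompl (j + 2)).const_mul _).add ((hcompl j).const_mul _))
    (squeeze_zero (fun j => measureReal_nonneg)
      (fun j => le_of_tendsto' (hcompl j) fun t => leftHitProb_le ρ t j)
      (tendsto_pow_atTop_nhds_zero_of_lt_one ρ.2.1.le ρ.2.2)) (j + 1)
  -- Leaving [y, ∞) from y + j takes a displacement of -(j+1), hence the exponent.
  have hset : staysRight y x i = (⋃ t, leftHit x i 0 t (j + 1))ᶜ := by
    ext ω
    simp only [staysRight, position, leftHit, Set.mem_ofPred_eq, Set.mem_compl_iff, Set.mem_iUnion,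
      not_exists, not_and, not_le, zero_add]
    constructor
    · intro h t k _
      have := h k
      push_cast
      omega
    · intro h k
      have := h k k le_rfl
      push_cast at this
      omega
  have hmeas : MeasurableSet (⋃ t, leftHit x i 0 t (j + 1)) :=
    MeasurableSet.iUnion fun t =>
      stepAlgebra_le Set.univ _ (measurableSet_leftHit (fun _ => Set.mem_univ _) t (j + 1))
  rw [hset, probReal_compl_eq_one_sub hmeas]
  exact congrArg _ hpow

/-! ### Transience to the right -/

lemma integral_step (ρ : Set.Ioo (0 : ℝ) 1) (c : ℤ × ℕ × ℕ) :
    Integrable (fun ω : Sample => (ω c : ℝ)) (law ρ) ∧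
      ∫ ω, (ω c : ℝ) ∂law ρ = 2 * rightProb ρ - 1 := by
  have h := rightProb_mem ρ
  have hm : Measurable fun e : ℤ => (e : ℝ) := measurable_from_top
  have hint : ∀ (r : ℝ) (e : ℤ), Integrable (fun e : ℤ => (e : ℝ))
      (ENNReal.ofReal r • Measure.dirac e) := fun r e =>
    (integrable_dirac (by simp)).smul_measure ENNReal.ofReal_ne_top
  have hi : Integrable (fun e : ℤ => (e : ℝ)) (stepLaw ρ) := (hint _ 1).add_measure (hint _ (-1))
  constructor
  · rw [← map_step ρ c] at hi
    exact hi.comp_measurable (measurable_pi_apply c)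
  · rw [← integral_map (φ := fun ω : Sample => ω c) (f := fun e : ℤ => (e : ℝ))
      (measurable_pi_apply c).aemeasurable hm.aestronglyMeasurable, map_step, stepLaw,
      integral_add_measure (hint _ 1) (hint _ (-1)), integral_smul_measure, integral_smul_measure,
      integral_dirac, integral_dirac, ENNReal.toReal_ofReal (by linarith [h.1]),
      ENNReal.toReal_ofReal (by linarith [h.2])]
    simp
    ring

/-- The strong law applies with drift 2p - 1 > 0. It ensures that one frog from the origin wakes the
whole right half-line. -/
lemma tendsto_position (ρ : Set.Ioo (0 : ℝ) 1) (x : ℤ) (i : ℕ) :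
    ∀ᵐ ω ∂law ρ, Tendsto (fun k => (position ω x i k : ℝ)) atTop atTop := by
  have hpair : Pairwise (Function.onFun (fun f g : Sample → ℝ => IndepFun f g (law ρ))
      fun (k : ℕ) (ω : Sample) => (ω (x, i, k) : ℝ)) := by
    intro k l hkl
    exact ((iIndepFun_step ρ).indepFun (i := (x, i, k)) (j := (x, i, l)) (by simpa using hkl)).comp
      (φ := fun e : ℤ => (e : ℝ)) (ψ := fun e : ℤ => (e : ℝ)) measurable_from_top
      measurable_from_top
  have hident : ∀ k : ℕ, IdentDistrib (fun ω : Sample => (ω (x, i, k) : ℝ))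
      (fun ω : Sample => (ω (x, i, 0) : ℝ)) (law ρ) (law ρ) := by
    intro k
    have : IdentDistrib (fun ω : Sample => ω (x, i, k)) (fun ω : Sample => ω (x, i, 0))
        (law ρ) (law ρ) :=
      ⟨(measurable_pi_apply _).aemeasurable, (measurable_pi_apply _).aemeasurable,
        by rw [map_step, map_step]⟩
    exact this.comp (u := fun e : ℤ => (e : ℝ)) measurable_from_top
  have h := strong_law_ae_real (fun (k : ℕ) (ω : Sample) => (ω (x, i, k) : ℝ))
    (integral_step ρ _).1 hpair hident
  rw [(integral_step ρ _).2] at h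
  filter_upwards [h] with ω hω
  have hpos : 0 < 2 * rightProb ρ - 1 := by linarith [(rightProb_mem ρ).1]
  have h2 := tendsto_natCast_atTop_atTop.atTop_mul_pos hpos hω
  have h3 : Tendsto (fun k : ℕ => (x : ℝ) + ∑ j ∈ Finset.range k, (ω (x, i, j) : ℝ))
      atTop atTop := by
    refine tendsto_atTop_add_const_left _ _ (h2.congr' ?_)
    filter_upwards [eventually_gt_atTop 0] with k hk
    have : (k : ℝ) ≠ 0 := by positivity
    field_simp
  refine h3.congr fun k => ?_
  simp [position]

/-! ### The activation dynamics -/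

section Dynamics

variable {η : ℤ → ℕ} {ω : Sample}

lemma position_zero (ω : Sample) (x : ℤ) (i : ℕ) : position ω x i 0 = x := by simp [position]

lemma position_succ (ω : Sample) (x : ℤ) (i k : ℕ) :
    position ω x i (k + 1) = position ω x i k + ω (x, i, k) := by
  simp [position, Finset.sum_range_succ, add_assoc]

lemma clock_succ_of_some {t : ℕ} {x : ℤ} {k : ℕ} (h : clock η ω t x = some k) :
    clock η ω (t + 1) x = some (k + 1) := by
  simp [clock, h]

lemma clock_succ_eq_some {t : ℕ} {x : ℤ} {k : ℕ} (h : clock η ω (t + 1) x = some k) :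
    (∃ k', clock η ω t x = some k' ∧ k = k' + 1) ∨
      k = 0 ∧ ∃ (y : ℤ) (i l : ℕ), i < η y ∧ clock η ω t y = some l ∧
        position ω y i (l + 1) = x := by
  rw [clock] at h
  split at h
  · next k' hk' => exact Or.inl ⟨k', hk', by simpa using h.symm⟩
  · split_ifs at h with hex
    exact Or.inr ⟨by simpa using h.symm, hex⟩

lemma exists_clock_zero {t : ℕ} {x : ℤ} {k : ℕ} (h : clock η ω t x = some k) :
    ∃ t₀, clock η ω t₀ x = some 0 := by
  induction t generalizing k with
  | zero =>
    rw [clock] at h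
    split_ifs at h with hx
    exact ⟨0, by simp [clock, hx]⟩
  | succ t ih =>
    rcases clock_succ_eq_some h with ⟨k', hk', _⟩ | ⟨rfl, _⟩
    · exact ih hk'
    · exact ⟨t + 1, h⟩

lemma clock_add {t : ℕ} {x : ℤ} (h : clock η ω t x = some 0) (k : ℕ) :
    clock η ω (t + k) x = some k := by
  induction k with
  | zero => exact h
  | succ k ih => exact clock_succ_of_some ih

/-- The frogs of the site `x` are activated at some time. -/
def IsActivated (η : ℤ → ℕ) (ω : Sample) (x : ℤ) : Prop := ∃ t, clock η ω t x = some 0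

lemma isActivated_zero : IsActivated η ω 0 := ⟨0, by simp [clock]⟩

/-- Activation is closed under following trajectories, so times can be forgotten in the leftward
induction. -/
lemma IsActivated.of_position {x y : ℤ} {i l : ℕ} (hy : IsActivated η ω y) (hi : i < η y)
    (hx : position ω y i l = x) : IsActivated η ω x := by
  obtain ⟨t, ht⟩ := hy
  rcases l with _ | l
  · rw [position_zero] at hx
    exact hx ▸ ⟨t, ht⟩
  · have hl := clock_add ht l
    -- The site may already be awake when the frog arrives; then its activation time is earlier.
    rcases h : clock η ω (t + l) x with _ | k
    · refine ⟨t + l + 1, ?_⟩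
      rw [clock, h]
      exact if_pos ⟨y, i, l, hi, hl, hx⟩
    · exact exists_clock_zero h

lemma IsActivated.mem_visited {x : ℤ} (hx : IsActivated η ω x) (hη : 0 < η x) :
    x ∈ visited η ω := by
  obtain ⟨t, ht⟩ := hx
  exact ⟨t, x, 0, 0, hη, ht, position_zero ω x 0⟩

/-- A walk with steps `±1` visits every site between two of its positions. -/
lemma exists_position_eq_of_le (hω : ∀ c, ω c = 1 ∨ ω c = -1) {x y : ℤ} {i : ℕ} {l : ℕ}
    (hyx : y ≤ x) (hl : position ω x i l ≤ y) : ∃ l, position ω x i l = y := by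
  induction l with
  | zero =>
    rw [position_zero] at hl
    exact ⟨0, by rw [position_zero]; omega⟩
  | succ l ih =>
    by_cases h : position ω x i l ≤ y
    · exact ih h
    · refine ⟨l + 1, ?_⟩
      rw [position_succ] at hl ⊢
      rcases hω (x, i, l) with h1 | h1 <;> omega

lemma exists_position_eq_of_ge (hω : ∀ c, ω c = 1 ∨ ω c = -1) {x y : ℤ} {i : ℕ} {l : ℕ}
    (hxy : x ≤ y) (hl : y ≤ position ω x i l) : ∃ l, position ω x i l = y := by
  induction l with
  | zero =>
    rw [position_zero] at hl
    exact ⟨0, by rw [position_zero]; omega⟩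
  | succ l ih =>
    by_cases h : y ≤ position ω x i l
    · exact ih h
    · refine ⟨l + 1, ?_⟩
      rw [position_succ] at hl ⊢
      rcases hω (x, i, l) with h1 | h1 <;> omega

end Dynamics

/-! ### The renewal events -/

/-- None of the frogs of the `N` sites from `-k` on ever walks to the left of `-k`. -/
def blockStays (n k N : ℕ) : Set Sample :=
  {ω | ∀ j < N, ∀ i < n, ω ∈ staysRight (-(k : ℤ)) (-(k : ℤ) + (j : ℤ)) i}

/-- None of the frogs of the sites `x ≥ -k` ever walks to the left of `-k`. -/
def halfLineStays (n k : ℕ) : Set Sample :=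
  {ω | ∀ x ≥ -(k : ℤ), ∀ i < n, ω ∈ staysRight (-(k : ℤ)) x i}

/-- The first renewal takes place at `k`. -/
def firstStays (n k : ℕ) : Set Sample :=
  {ω | ω ∈ halfLineStays n k ∧ ∀ j < k, ω ∉ halfLineStays n j}

/-- By induction on time, every awake frog started at or to the right of `-k`, and such frogs never
cross `-k`. -/
lemma minusLeftmost_le {n k : ℕ} {ω : Sample} (h : ω ∈ halfLineStays n k) :
    minusLeftmost (fun _ => n) ω ≤ k := by
  have hact : ∀ t y c, clock (fun _ => n) ω t y = some c → -(k : ℤ) ≤ y := by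
    intro t
    induction t with
    | zero =>
      intro y c hc
      rw [clock] at hc
      split_ifs at hc with hy
      omega
    | succ t ih =>
      intro y c hc
      rcases clock_succ_eq_some hc with ⟨c', hc', _⟩ | ⟨_, z, i, l, hi, hz, hp⟩
      · exact ih y c' hc'
      · exact hp ▸ h z (ih z l hz) i hi (l + 1)
  refine iSup₂_le fun x hx => ?_
  obtain ⟨t, y, i, c, hi, hc, rfl⟩ := hx
  have := h y (hact t y c hc) i hi c
  exact_mod_cast (by omega : (-position ω y i c).toNat ≤ k)

/-- If all sites from `-j` on are awake and `-j` is no renewal, some awake frog crosses `-j`; its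
unit steps make it hit and wake `-j - 1`. -/
lemma le_minusLeftmost {n k : ℕ} (hn : 1 ≤ n) {ω : Sample} (hω : ∀ c, ω c = 1 ∨ ω c = -1)
    (htop : Tendsto (fun k => (position ω 0 0 k : ℝ)) atTop atTop)
    (h : ∀ j < k, ω ∉ halfLineStays n j) : (k : ℝ≥0∞) ≤ minusLeftmost (fun _ => n) ω := by
  have hright : ∀ x : ℤ, 0 ≤ x → IsActivated (fun _ => n) ω x := by
    intro x hx
    obtain ⟨l, hl⟩ := (htop.eventually_ge_atTop (x : ℝ)).exists
    obtain ⟨l, hl⟩ := exists_position_eq_of_ge hω hx (by exact_mod_cast hl)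
    exact isActivated_zero.of_position (show 0 < n from hn) hl
  have hleft : ∀ j ≤ k, ∀ x : ℤ, -(j : ℤ) ≤ x → IsActivated (fun _ => n) ω x := by
    intro j
    induction j with
    | zero => exact fun _ x hx => hright x (by simpa using hx)
    | succ j ih =>
      intro hj x hx
      have ih := ih (by omega)
      by_cases hxj : -(j : ℤ) ≤ x
      · exact ih x hxj
      · have hx' : x = -(j : ℤ) - 1 := by push_cast at hx; omega
        have hj' := h j (by omega)
        simp only [halfLineStays, staysRight, Set.mem_ofPred_eq, not_forall, not_le] at hj'
        obtain ⟨y, hy, i, hi, l, hl⟩ := hj'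
        obtain ⟨l, hl⟩ := exists_position_eq_of_le hω (y := x) (by omega)
          (by omega : position ω y i l ≤ x)
        exact (ih y hy).of_position hi hl
  have hvis := (hleft k le_rfl (-(k : ℤ)) le_rfl).mem_visited (show 0 < n from hn)
  refine le_trans ?_ (le_iSup₂ (f := fun x (_ : x ∈ visited (fun _ => n) ω) =>
    ((-x).toNat : ℝ≥0∞)) _ hvis)
  simp

lemma measurableSet_blockStays {S : Set (ℤ × ℕ × ℕ)} {n k N : ℕ}
    (h : ∀ j < N, ∀ i l, (-(k : ℤ) + (j : ℤ), i, l) ∈ S) :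
    MeasurableSet[stepAlgebra S] (blockStays n k N) := by
  have : blockStays n k N = ⋂ j, ⋂ (_ : j < N), ⋂ i, ⋂ (_ : i < n),
      staysRight (-(k : ℤ)) (-(k : ℤ) + (j : ℤ)) i := by
    ext ω
    simp [blockStays]
  rw [this]
  exact MeasurableSet.iInter fun j => MeasurableSet.iInter fun hj => MeasurableSet.iInter fun i =>
    MeasurableSet.iInter fun _ => measurableSet_staysRight (fun l => h j hj i l) _

lemma halfLineStays_eq_iInter (n k : ℕ) : halfLineStays n k = ⋂ N, blockStays n k N := by
  ext ω
  simp only [halfLineStays, blockStays, Set.mem_iInter, Set.mem_ofPred_eq]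
  constructor
  · exact fun h N j _ i hi => h _ (by omega) i hi
  · intro h x hx i hi
    have := h ((x + k).toNat + 1) (x + k).toNat (by omega) i hi
    rwa [show -(k : ℤ) + ((x + k).toNat : ℤ) = x by omega] at this

lemma measurableSet_halfLineStays {S : Set (ℤ × ℕ × ℕ)} {n k : ℕ}
    (h : ∀ x ≥ -(k : ℤ), ∀ i l, (x, i, l) ∈ S) :
    MeasurableSet[stepAlgebra S] (halfLineStays n k) := by
  rw [halfLineStays_eq_iInter]
  exact MeasurableSet.iInter fun N => measurableSet_blockStays fun j _ i l => h _ (by omega) i l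

/-- The excluded renewals at j < k involve only sites to the right of `-j`, inclusive, so the event
ignores all frogs left of `-k`. -/
lemma measurableSet_firstStays {S : Set (ℤ × ℕ × ℕ)} {n k : ℕ}
    (h : ∀ x ≥ -(k : ℤ), ∀ i l, (x, i, l) ∈ S) :
    MeasurableSet[stepAlgebra S] (firstStays n k) := by
  have : firstStays n k = halfLineStays n k ∩ ⋂ j, ⋂ (_ : j < k), (halfLineStays n j)ᶜ := by
    ext ω
    simp [firstStays]
  rw [this]
  exact (measurableSet_halfLineStays h).inter <| MeasurableSet.iInter fun j =>
    MeasurableSet.iInter fun hj =>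
      (measurableSet_halfLineStays fun x hx => h x (by omega)).compl

lemma measurableSet_halfLineStays' (n k : ℕ) : MeasurableSet (halfLineStays n k) :=
  stepAlgebra_le Set.univ _ (measurableSet_halfLineStays fun _ _ _ _ => Set.mem_univ _)

lemma measurableSet_firstStays' (n k : ℕ) : MeasurableSet (firstStays n k) :=
  stepAlgebra_le Set.univ _ (measurableSet_firstStays fun _ _ _ _ => Set.mem_univ _)

lemma measureReal_site (ρ : Set.Ioo (0 : ℝ) 1) (y : ℤ) (j n : ℕ) :
    (law ρ).real {ω | ∀ i < n, ω ∈ staysRight y (y + (j : ℤ)) i} = (1 - (ρ : ℝ) ^ (j + 1)) ^ n := by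
  induction n with
  | zero => simp
  | succ n ih =>
    have hset : {ω : Sample | ∀ i < n + 1, ω ∈ staysRight y (y + (j : ℤ)) i}
        = {ω | ∀ i < n, ω ∈ staysRight y (y + (j : ℤ)) i} ∩ staysRight y (y + (j : ℤ)) n := by
      ext ω
      exact Nat.forall_lt_succ_right
    have hA : MeasurableSet[stepAlgebra {c | c.2.1 < n}]
        {ω : Sample | ∀ i < n, ω ∈ staysRight y (y + (j : ℤ)) i} := by
      have : {ω : Sample | ∀ i < n, ω ∈ staysRight y (y + (j : ℤ)) i}
          = ⋂ i, ⋂ (_ : i < n), staysRight y (y + (j : ℤ)) i := by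
        ext ω
        simp
      rw [this]
      exact MeasurableSet.iInter fun i => MeasurableSet.iInter fun hi =>
        measurableSet_staysRight (fun l => hi) y
    have hB : MeasurableSet[stepAlgebra {c | c.2.1 = n}] (staysRight y (y + (j : ℤ)) n) :=
      measurableSet_staysRight (fun l => rfl) y
    rw [hset, measureReal_inter_of_disjoint ρ ?_ hA hB, ih, measureReal_staysRight, pow_succ _ n]
    exact Set.disjoint_left.2 fun c h1 h2 => ne_of_lt (Set.mem_ofPred.1 h1) h2

lemma measureReal_blockStays (ρ : Set.Ioo (0 : ℝ) 1) (n k N : ℕ) :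
    (law ρ).real (blockStays n k N) = potential n ρ N := by
  induction N with
  | zero => simp [blockStays, potential_zero]
  | succ N ih =>
    have hset : blockStays n k (N + 1) = blockStays n k N ∩
        {ω | ∀ i < n, ω ∈ staysRight (-(k : ℤ)) (-(k : ℤ) + (N : ℤ)) i} := by
      ext ω
      exact Nat.forall_lt_succ_right
    have hA : MeasurableSet[stepAlgebra {c | c.1 < -(k : ℤ) + (N : ℤ)}] (blockStays n k N) :=
      measurableSet_blockStays fun j hj i l => by
        change -(k : ℤ) + (j : ℤ) < -(k : ℤ) + (N : ℤ)
        omega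
    have hB : MeasurableSet[stepAlgebra {c | c.1 = -(k : ℤ) + (N : ℤ)}]
        {ω : Sample | ∀ i < n, ω ∈ staysRight (-(k : ℤ)) (-(k : ℤ) + (N : ℤ)) i} := by
      have : {ω : Sample | ∀ i < n, ω ∈ staysRight (-(k : ℤ)) (-(k : ℤ) + (N : ℤ)) i}
          = ⋂ i, ⋂ (_ : i < n), staysRight (-(k : ℤ)) (-(k : ℤ) + (N : ℤ)) i := by
        ext ω
        simp
      rw [this]
      exact MeasurableSet.iInter fun i => MeasurableSet.iInter fun _ =>
        measurableSet_staysRight (fun l => rfl) _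
    rw [hset, measureReal_inter_of_disjoint ρ ?_ hA hB, ih, measureReal_site, potential_succ]
    exact Set.disjoint_left.2 fun c h1 h2 => ne_of_lt (Set.mem_ofPred.1 h1) h2

/-- The probability of a renewal at a given site. -/
noncomputable def renewalProb (n : ℕ) (ρ : Set.Ioo (0 : ℝ) 1) : ℝ :=
  (law ρ).real (halfLineStays n 0)

lemma tendsto_potential (n k : ℕ) (ρ : Set.Ioo (0 : ℝ) 1) :
    Tendsto (potential n ρ) atTop (𝓝 ((law ρ).real (halfLineStays n k))) := by
  have hanti : Antitone (blockStays n k) := fun N M hNM ω h j hj => h j (by omega)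
  have h := tendsto_measure_iInter_atTop (μ := law ρ) (s := blockStays n k)
    (fun N => (stepAlgebra_le Set.univ _
      (measurableSet_blockStays fun _ _ _ _ => Set.mem_univ _)).nullMeasurableSet)
    hanti ⟨0, measure_ne_top _ _⟩
  rw [← halfLineStays_eq_iInter] at h
  refine ((ENNReal.tendsto_toReal (measure_ne_top _ _)).comp h).congr fun N => ?_
  exact measureReal_blockStays ρ n k N

lemma measureReal_halfLineStays (n k : ℕ) (ρ : Set.Ioo (0 : ℝ) 1) :
    (law ρ).real (halfLineStays n k) = renewalProb n ρ :=
  tendsto_nhds_unique (tendsto_potential n k ρ) (tendsto_potential n 0 ρ)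

lemma renewalProb_le_potential (n : ℕ) (ρ : Set.Ioo (0 : ℝ) 1) (N : ℕ) :
    renewalProb n ρ ≤ potential n ρ N :=
  (potential_antitone ρ.2).le_of_tendsto (tendsto_potential n 0 ρ) N

lemma sum_measureReal_firstStays_mul (n : ℕ) (ρ : Set.Ioo (0 : ℝ) 1) (k : ℕ) :
    ∑ j ∈ Finset.range (k + 1), (law ρ).real (firstStays n j) * potential n ρ (k - j)
      = renewalProb n ρ := by
  have hterm : ∀ j ∈ Finset.range (k + 1),
      (law ρ).real (firstStays n j) * potential n ρ (k - j)
        = (law ρ).real (firstStays n j ∩ halfLineStays n k) := by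
    intro j hj
    have hjk : j ≤ k := Nat.lt_succ_iff.1 (Finset.mem_range.1 hj)
    -- After a renewal at `-j`, the frogs from there on stay right of `-j ≥ -k`. Only the `k - j`
    -- sites between `-k` and `-j - 1` remain, and their steps are independent of `firstStays n j`.
    have hset : firstStays n j ∩ halfLineStays n k = firstStays n j ∩ blockStays n k (k - j) := by
      ext ω
      refine and_congr_right fun hω => ⟨fun h a _ i hi => h _ (by omega) i hi, ?_⟩
      intro h x hx i hi
      by_cases hxj : -(j : ℤ) ≤ x
      · exact fun l => le_trans (by omega) (hω.1 x hxj i hi l)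
      · have := h (x + k).toNat (by omega) i hi
        rwa [show -(k : ℤ) + ((x + k).toNat : ℤ) = x by omega] at this
    have hA : MeasurableSet[stepAlgebra {c | -(j : ℤ) ≤ c.1}] (firstStays n j) :=
      measurableSet_firstStays fun x hx i l => hx
    have hB : MeasurableSet[stepAlgebra {c | c.1 < -(j : ℤ)}] (blockStays n k (k - j)) :=
      measurableSet_blockStays fun a ha i l => by
        change -(k : ℤ) + (a : ℤ) < -(j : ℤ)
        omega
    rw [hset, measureReal_inter_of_disjoint ρ ?_ hA hB, measureReal_blockStays]
    exact Set.disjoint_left.2 fun c h1 h2 => not_lt_of_ge (Set.mem_ofPred.1 h1) h2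
  have hcover : halfLineStays n k
      = ⋃ j ∈ Finset.range (k + 1), firstStays n j ∩ halfLineStays n k := by
    classical
    ext ω
    simp only [Set.mem_iUnion, Finset.mem_range, exists_prop, Set.mem_inter_iff]
    refine ⟨fun h => ?_, fun ⟨_, _, _, h⟩ => h⟩
    have hex : ∃ j, ω ∈ halfLineStays n j := ⟨k, h⟩
    exact ⟨Nat.find hex, Nat.lt_succ_of_le (Nat.find_min' hex h),
      ⟨Nat.find_spec hex, fun j hj => Nat.find_min hex hj⟩, h⟩
  rw [Finset.sum_congr rfl hterm, ← measureReal_halfLineStays n k ρ]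
  conv_rhs => rw [hcover]
  refine (measureReal_biUnion_finset ?_ fun j _ =>
    (measurableSet_firstStays' n j).inter (measurableSet_halfLineStays' n k)).symm
  intro a _ b _ hab
  refine Set.disjoint_left.2 fun ω h1 h2 => ?_
  rcases lt_or_gt_of_ne hab with h | h
  · exact h2.1.2 a h h1.1.1
  · exact h1.1.2 b h h2.1.1

/-! ### Bounds for the moments -/

section Moments

variable {n : ℕ} (ρ : Set.Ioo (0 : ℝ) 1)

lemma potential_eq_pow (n : ℕ) (ρ : ℝ) (N : ℕ) :
    potential n ρ N = (∏ j ∈ Finset.range N, (1 - ρ ^ (j + 1))) ^ n :=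
  Finset.prod_pow _ _ _

lemma renewalProb_pos (n : ℕ) : 0 < renewalProb n ρ := by
  have hρ := ρ.2
  have hσ : 0 < (1 - (ρ : ℝ)) / ρ := div_pos (by linarith [hρ.2]) hρ.1
  have hρ' : (ρ : ℝ) = 1 / (1 + (1 - (ρ : ℝ)) / ρ) := by
    have := hρ.1.ne'
    field_simp
    ring
  set C := 1 / ((1 - (ρ : ℝ)) / ρ) * (Real.pi ^ 2 / 6) + Real.pi ^ 2 / 12 with hC
  refine lt_of_lt_of_le (pow_pos (Real.exp_pos (-C)) n)
    (ge_of_tendsto' (tendsto_potential n 0 ρ) fun N => ?_)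
  rw [potential_eq_pow]
  -- The cutoff 0 is enough: only a bound uniform in `N` is needed.
  have h := neg_log_prod_le hσ hρ' N 0
  simp only [CharP.cast_eq_zero, zero_add, Real.log_one, zero_div, sub_zero, zero_mul,
    add_zero] at h
  have hpos : 0 < ∏ j ∈ Finset.range N, (1 - (ρ : ℝ) ^ (j + 1)) :=
    Finset.prod_pos fun j _ => (one_sub_pow_mem hρ j).1
  refine pow_le_pow_left₀ (Real.exp_pos _).le ?_ n
  rw [← Real.le_log_iff_exp_le hpos]
  linarith

lemma renewalProb_le_one (n : ℕ) : renewalProb n ρ ≤ 1 := measureReal_le_one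

lemma sum_measureReal_firstStays_mul_pow_le (hn : 1 ≤ n) (K : ℕ) :
    ∑ k ∈ Finset.range K, (law ρ).real (firstStays n k) *
      (1 + (1 - (ρ : ℝ)) * renewalProb n ρ / (6 * n)) ^ k ≤ 2 :=
  sum_renewal_mul_pow_le_two (fun _ => measureReal_nonneg) (potential_antitone ρ.2)
    potential_zero (sum_measureReal_firstStays_mul n ρ)
    (by
      have := (renewalProb_pos ρ n).le
      have : 0 ≤ 1 - (ρ : ℝ) := by linarith [ρ.2.2]
      positivity)
    (sum_potential_sub_mul_pow_le hn ρ.2 (renewalProb_pos ρ n).le (renewalProb_le_potential n ρ)) K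

/-- The first-renewal probabilities sum to 1 by `tsum_renewal_eq_one`; summability comes from the
exponential moment, whose weights are at least 1. -/
lemma ae_exists_mem_firstStays (hn : 1 ≤ n) : ∀ᵐ ω ∂law ρ, ∃ k, ω ∈ firstStays n k := by
  have hpos := renewalProb_pos ρ n
  have hε : 0 ≤ (1 - (ρ : ℝ)) * renewalProb n ρ / (6 * n) := by
    have : 0 ≤ 1 - (ρ : ℝ) := by linarith [ρ.2.2]
    positivity
  have hsum : Summable fun k => (law ρ).real (firstStays n k) :=
    summable_of_sum_range_le (c := 2) (fun _ => measureReal_nonneg) fun K =>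
      (Finset.sum_le_sum fun k _ => le_mul_of_one_le_right measureReal_nonneg
        (one_le_pow₀ (by linarith))).trans (sum_measureReal_firstStays_mul_pow_le ρ hn K)
  have h1 := tsum_renewal_eq_one (fun _ => measureReal_nonneg) hsum
    (fun k => by
      rw [abs_of_pos (potential_pos ρ.2 k)]
      exact potential_le_one ρ.2 k)
    (tendsto_potential n 0 ρ) hpos.ne' (sum_measureReal_firstStays_mul n ρ)
  have hdisj : Pairwise (Function.onFun Disjoint (firstStays n)) := by
    intro a b hab
    refine Set.disjoint_left.2 fun ω h1 h2 => ?_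
    rcases lt_or_gt_of_ne hab with h | h
    · exact h2.2 a h h1.1
    · exact h1.2 b h h2.1
  have hunion : law ρ (⋃ k, firstStays n k) = 1 := by
    rw [measure_iUnion hdisj (measurableSet_firstStays' n), ← ENNReal.ofReal_one, ← h1,
      ENNReal.ofReal_tsum_of_nonneg (fun _ => measureReal_nonneg) hsum]
    exact tsum_congr fun k => (ofReal_measureReal (measure_ne_top _ _)).symm
  have := (prob_compl_eq_zero_iff
    (MeasurableSet.iUnion (measurableSet_firstStays' n))).2 hunion
  filter_upwards [measure_eq_zero_iff_ae_notMem.1 this] with ω hω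
  simpa using hω

/-- The leftmost site is bounded by the first renewal, and k^m by the weight (1+ε)^k, whose
expectation is at most 2. -/
lemma moment_le (hn : 1 ≤ n) (m : ℕ) :
    moment n m ρ ≤ ENNReal.ofReal
      (2 * m.factorial * (12 * n / ((1 - (ρ : ℝ)) * renewalProb n ρ)) ^ m) := by
  have hpos := renewalProb_pos ρ n
  have h1ρ : 0 < 1 - (ρ : ℝ) := by linarith [ρ.2.2]
  have hn' : (1 : ℝ) ≤ n := by exact_mod_cast hn
  set ε := (1 - (ρ : ℝ)) * renewalProb n ρ / (6 * n) with hεdef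
  have hε : 0 < ε := by positivity
  have hε1 : ε ≤ 1 := by
    rw [hεdef, div_le_one (by positivity)]
    have := mul_le_one₀ (by linarith [ρ.2.1] : 1 - (ρ : ℝ) ≤ 1) hpos.le (renewalProb_le_one ρ n)
    linarith
  have hε2 : 2 / ε = 12 * n / ((1 - (ρ : ℝ)) * renewalProb n ρ) := by
    rw [hεdef]
    field_simp
    norm_num
  rw [← hε2]
  calc moment n m ρ
      ≤ ∫⁻ ω, ∑' k : ℕ, (firstStays n k).indicator (fun _ => (k : ℝ≥0∞) ^ m) ω ∂law ρ := by
        refine lintegral_mono_ae ?_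
        filter_upwards [ae_exists_mem_firstStays ρ hn] with ω ⟨k, hk⟩
        refine le_trans ?_ (ENNReal.le_tsum (f := fun k : ℕ =>
          (firstStays n k).indicator (fun _ => (k : ℝ≥0∞) ^ m) ω) k)
        rw [Set.indicator_of_mem hk]
        gcongr
        exact minusLeftmost_le hk.1
    _ = ∑' k : ℕ, (k : ℝ≥0∞) ^ m * law ρ (firstStays n k) := by
        rw [lintegral_tsum fun k =>
          (measurable_const.indicator (measurableSet_firstStays' n k)).aemeasurable]
        exact tsum_congr fun k => lintegral_indicator_const (measurableSet_firstStays' n k) _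
    _ ≤ _ := by
        refine ENNReal.tsum_le_of_sum_range_le fun K => ?_
        have hterm : ∀ k : ℕ, (k : ℝ≥0∞) ^ m * law ρ (firstStays n k)
            = ENNReal.ofReal ((k : ℝ) ^ m * (law ρ).real (firstStays n k)) := fun k => by
          rw [ENNReal.ofReal_mul (by positivity), ENNReal.ofReal_pow (by positivity),
            ENNReal.ofReal_natCast, ofReal_measureReal (measure_ne_top _ _)]
        simp only [hterm]
        rw [← ENNReal.ofReal_sum_of_nonneg fun k _ =>
          mul_nonneg (by positivity) measureReal_nonneg]
        refine ENNReal.ofReal_le_ofReal ?_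
        calc ∑ k ∈ Finset.range K, (k : ℝ) ^ m * (law ρ).real (firstStays n k)
            ≤ ∑ k ∈ Finset.range K, m.factorial * (2 / ε) ^ m *
              ((law ρ).real (firstStays n k) * (1 + ε) ^ k) := by
              refine Finset.sum_le_sum fun k _ => ?_
              refine (mul_le_mul_of_nonneg_right (nat_pow_le_mul_one_add_pow hε hε1 k m)
                measureReal_nonneg).trans (le_of_eq ?_)
              ring
          _ ≤ m.factorial * (2 / ε) ^ m * 2 := by
              rw [← Finset.mul_sum]
              gcongr
              exact sum_measureReal_firstStays_mul_pow_le ρ hn K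
          _ = _ := by ring

/-- Union bound: with probability at least 1/2 none of `0, …, k - 1` is a renewal. -/
lemma le_moment (hn : 1 ≤ n) (m : ℕ) {k : ℕ} (hk : k * renewalProb n ρ ≤ 1 / 2) :
    ENNReal.ofReal ((k : ℝ) ^ m / 2) ≤ moment n m ρ := by
  set B : Set Sample := ⋃ j ∈ Finset.range k, halfLineStays n j with hB
  have hBm : MeasurableSet B :=
    Finset.measurableSet_biUnion _ fun j _ => measurableSet_halfLineStays' n j
  have hBle : (law ρ).real B ≤ 1 / 2 := by
    refine (measureReal_biUnion_finset_le _ _).trans ?_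
    simpa [measureReal_halfLineStays] using hk
  have hBc : 1 / 2 ≤ (law ρ).real Bᶜ := by
    rw [probReal_compl_eq_one_sub hBm]
    linarith
  calc ENNReal.ofReal ((k : ℝ) ^ m / 2) ≤ ENNReal.ofReal ((k : ℝ) ^ m * (law ρ).real Bᶜ) := by
        refine ENNReal.ofReal_le_ofReal ?_
        rw [div_eq_mul_one_div]
        gcongr
    _ = (k : ℝ≥0∞) ^ m * law ρ Bᶜ := by
        rw [ENNReal.ofReal_mul (by positivity), ENNReal.ofReal_pow (by positivity),
          ENNReal.ofReal_natCast, ofReal_measureReal (measure_ne_top _ _)]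
    _ = ∫⁻ ω, Bᶜ.indicator (fun _ => (k : ℝ≥0∞) ^ m) ω ∂law ρ :=
        (lintegral_indicator_const hBm.compl _).symm
    _ ≤ moment n m ρ := by
        refine lintegral_mono_ae ?_
        filter_upwards [ae_step ρ, tendsto_position ρ 0 0] with ω h1 h2
        by_cases hω : ω ∈ Bᶜ
        · rw [Set.indicator_of_mem hω]
          gcongr
          refine le_minusLeftmost hn h1 h2 fun j hj hmem => hω ?_
          exact Set.mem_biUnion (Finset.mem_coe.2 (Finset.mem_range.2 hj)) hmem
        · rw [Set.indicator_of_notMem hω]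
          exact zero_le

end Moments

/-! ### Asymptotics -/

/-- By Bernoulli ρ^N ≥ 1/2 for N = ⌊1/(2(1-ρ))⌋, so each of the first N factors is at most 1/2 ≤
e^{-1/2}. -/
lemma renewalProb_le_exp {n : ℕ} (hn : 1 ≤ n) (ρ : Set.Ioo (0 : ℝ) 1) :
    renewalProb n ρ ≤ Real.exp (1 / 2 - 1 / (4 * (1 - (ρ : ℝ)))) := by
  have hρ := ρ.2
  have h1ρ : 0 < 1 - (ρ : ℝ) := by linarith [hρ.2]
  set N := ⌊1 / (2 * (1 - (ρ : ℝ)))⌋₊ with hN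
  have hNle : N * (1 - (ρ : ℝ)) ≤ 1 / 2 := by
    have := Nat.floor_le (a := 1 / (2 * (1 - (ρ : ℝ)))) (by positivity)
    rw [le_div_iff₀ (by positivity)] at this
    linarith
  have hNge : 1 / (2 * (1 - (ρ : ℝ))) ≤ N + 1 := (Nat.lt_floor_add_one _).le
  have hρN : 1 / 2 ≤ (ρ : ℝ) ^ N := by
    have := one_add_mul_le_pow (a := -(1 - (ρ : ℝ))) (by linarith [hρ.1]) N
    have h2 : 1 + -(1 - (ρ : ℝ)) = ρ := by ring
    rw [h2] at this
    linarith
  have hexp : (1 / 2 : ℝ) ≤ Real.exp (-(1 / 2)) := by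
    have := Real.add_one_le_exp (-(1 / 2) : ℝ)
    linarith
  calc renewalProb n ρ ≤ potential n ρ N := renewalProb_le_potential n ρ N
    _ ≤ ∏ _j ∈ Finset.range N, Real.exp (-(1 / 2)) := by
      refine Finset.prod_le_prod (fun j _ => pow_nonneg (one_sub_pow_mem hρ j).1.le n)
        fun j hj => ?_
      have hj' : j + 1 ≤ N := Finset.mem_range.1 hj
      refine (pow_le_of_le_one (one_sub_pow_mem hρ j).1.le (one_sub_pow_mem hρ j).2.le
        (by omega)).trans ?_
      have := pow_le_pow_of_le_one hρ.1.le hρ.2.le hj'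
      linarith
    _ = Real.exp (N * (-(1 / 2))) := by
      rw [Finset.prod_const, Finset.card_range, Real.exp_nat_mul]
    _ ≤ _ := by
      refine Real.exp_le_exp.2 ?_
      have : 1 / (4 * (1 - (ρ : ℝ))) = 1 / (2 * (1 - (ρ : ℝ))) / 2 := by
        field_simp
        norm_num
      linarith

lemma tendsto_one_sub : Tendsto (fun ρ : ℝ => 1 - ρ) (𝓝[<] 1) (𝓝[>] 0) := by
  refine tendsto_nhdsWithin_iff.2 ⟨?_, ?_⟩
  · have : Tendsto (fun ρ : ℝ => 1 - ρ) (𝓝 1) (𝓝 (1 - 1)) := tendsto_const_nhds.sub tendsto_id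
    rw [sub_self] at this
    exact this.mono_left nhdsWithin_le_nhds
  · filter_upwards [self_mem_nhdsWithin] with ρ hρ
    exact sub_pos.2 (Set.mem_Iio.1 hρ)

lemma eventually_mem_Ioo : ∀ᶠ ρ : ℝ in 𝓝[<] 1, ρ ∈ Set.Ioo (1 / 2 : ℝ) 1 :=
  Ioo_mem_nhdsLT (by norm_num)

lemma neg_log_div_two_le_Z_mul {ρ : ℝ} (hρ : ρ ∈ Set.Ioo (1 / 2 : ℝ) 1) :
    -Real.log (1 - ρ) / 2 ≤ Z ρ * (1 - ρ) := by
  obtain ⟨h2, h1⟩ := hρ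
  have h0 : 0 < ρ := by linarith
  have hs : 0 < 1 - ρ := by linarith
  have hlog : Real.log ρ < 0 := Real.log_neg h0 h1
  have hlogs : Real.log (1 - ρ) ≤ 0 := Real.log_nonpos hs.le (by linarith)
  have hge := Real.one_sub_inv_le_log_of_pos h0
  have hinv : ρ⁻¹ - 1 ≤ 2 * (1 - ρ) := by
    rw [inv_eq_one_div, div_sub_one h0.ne', div_le_iff₀ h0]
    nlinarith
  have hZ : Z ρ * (1 - ρ) = -Real.log (1 - ρ) * (1 - ρ) / (-Real.log ρ) := by
    rw [Z, neg_mul, neg_div_neg_eq]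
    ring
  rw [hZ, div_le_div_iff₀ (by norm_num) (by linarith)]
  nlinarith [mul_le_mul_of_nonneg_left (by linarith : -Real.log ρ ≤ 2 * (1 - ρ))
    (neg_nonneg.2 hlogs)]

lemma tendsto_Z_mul : Tendsto (fun ρ : ℝ => Z ρ * (1 - ρ)) (𝓝[<] 1) atTop := by
  have h : Tendsto (fun ρ : ℝ => -Real.log (1 - ρ) / 2) (𝓝[<] 1) atTop :=
    (tendsto_neg_atBot_atTop.comp
      (Real.tendsto_log_nhdsGT_zero.comp tendsto_one_sub)).atTop_div_const (by norm_num)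
  refine tendsto_atTop_mono' _ ?_ h
  filter_upwards [eventually_mem_Ioo] with ρ hρ
  exact neg_log_div_two_le_Z_mul hρ

lemma Z_nonneg {ρ : ℝ} (hρ : ρ ∈ Set.Ioo (0 : ℝ) 1) : 0 ≤ Z ρ :=
  div_nonneg_of_nonpos (Real.log_nonpos (by linarith [hρ.2]) (by linarith [hρ.1]))
    (Real.log_nonpos hρ.1.le hρ.2.le)

lemma Z_le {ρ : ℝ} (hρ : ρ ∈ Set.Ioo (0 : ℝ) 1) : Z ρ ≤ (1 / (1 - ρ)) ^ 2 := by
  obtain ⟨h0, h1⟩ := hρ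
  have hs : 0 < 1 - ρ := by linarith
  have h2 : 1 - ρ ≤ -Real.log ρ := by linarith [Real.log_le_sub_one_of_pos h0]
  have h3 : -Real.log (1 - ρ) ≤ 1 / (1 - ρ) := by
    have := Real.one_sub_inv_le_log_of_pos hs
    rw [inv_eq_one_div] at this
    linarith
  calc Z ρ = -Real.log (1 - ρ) / (-Real.log ρ) := by rw [Z, neg_div_neg_eq]
    _ ≤ 1 / (1 - ρ) / (1 - ρ) := div_le_div₀ (by positivity) h3 hs h2
    _ = _ := by field_simp

/-- The upper bound for the `m`-th moment. -/
noncomputable def upperRate (n m : ℕ) (ρ : ℝ) : ℝ :=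
  Z ρ ^ m * ((1 - ρ) / (2 * Real.pi)) ^ ((n : ℝ) / 2) *
    Real.exp (Real.pi ^ 2 / 6 * ((m : ℝ) * n / (1 - ρ)))

/-- The lower bound for the `m`-th moment. -/
noncomputable def lowerRate (n m : ℕ) (δ ρ : ℝ) : ℝ :=
  (m.factorial : ℝ) * Z ρ ^ m * Real.exp ((m : ℝ) * n / (1 - ρ) ^ δ)

lemma one_div_renewalProb_le (n : ℕ) :
    ∃ c : ℝ, 0 < c ∧ ∀ ρ : Set.Ioo (0 : ℝ) 1, 1 / 2 ≤ (ρ : ℝ) →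
      1 / renewalProb n ρ ≤ c * ((1 - (ρ : ℝ)) ^ ((n : ℝ) / 2) *
        Real.exp (Real.pi ^ 2 / 6 * (n / (1 - (ρ : ℝ))))) := by
  obtain ⟨c, hc, h⟩ := exists_le_prod_one_sub_pow
  refine ⟨1 / c ^ n, by positivity, fun ρ hρ => ?_⟩
  have hs : 0 < 1 - (ρ : ℝ) := by linarith [ρ.2.2]
  have hle : (c * ((1 - (ρ : ℝ)) ^ (-(1 / 2) : ℝ) *
      Real.exp (-(Real.pi ^ 2 / 6 / (1 - (ρ : ℝ)))))) ^ n ≤ renewalProb n ρ := by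
    refine ge_of_tendsto' (tendsto_potential n 0 ρ) fun N => ?_
    rw [potential_eq_pow]
    refine pow_le_pow_left₀ (by positivity) ?_ n
    have := h (1 - (ρ : ℝ)) hs (by linarith) N
    simpa only [sub_sub_cancel] using this
  refine (one_div_le_one_div_of_le (by positivity) hle).trans (le_of_eq ?_)
  rw [mul_pow, mul_pow, ← Real.rpow_mul_natCast hs.le, ← Real.exp_nat_mul,
    show (-(1 / 2) : ℝ) * n = -((n : ℝ) / 2) by ring,
    show (n : ℝ) * -(Real.pi ^ 2 / 6 / (1 - (ρ : ℝ)))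
      = -(Real.pi ^ 2 / 6 * (n / (1 - (ρ : ℝ)))) by ring, Real.rpow_neg hs.le, Real.exp_neg]
  field_simp

lemma eventually_moment_le (n m : ℕ) (hn : 1 ≤ n) (hm : 1 ≤ m) :
    ∀ᶠ r in 𝓝[<] (1 : ℝ), ∀ h : r ∈ Set.Ioo (0 : ℝ) 1,
      moment n m ⟨r, h⟩ ≤ ENNReal.ofReal (upperRate n m r) := by
  obtain ⟨c, hc, hu⟩ := one_div_renewalProb_le n
  set P : ℝ := (2 * Real.pi) ^ ((n : ℝ) / 2) with hP
  have hPpos : 0 < P := Real.rpow_pos_of_pos (by positivity) _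
  -- `A` collects every constant; it is absorbed by (Z_r(1-r))^m, which tends to infinity.
  set A : ℝ := 2 * m.factorial * (12 * n * c) ^ m * P with hA
  filter_upwards [eventually_mem_Ioo, tendsto_Z_mul.eventually_ge_atTop (max A 1)]
    with r hr hZ h
  refine (moment_le ⟨r, h⟩ hn m).trans (ENNReal.ofReal_le_ofReal ?_)
  have hs : 0 < 1 - r := by linarith [h.2]
  have hpos := renewalProb_pos ⟨r, h⟩ n
  have hZm : A ≤ (Z r * (1 - r)) ^ m :=
    (le_max_left A 1).trans (hZ.trans (le_self_pow₀ ((le_max_right A 1).trans hZ) (by omega)))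
  set w : ℝ := (1 - r) ^ ((n : ℝ) / 2) with hw
  set E : ℝ := Real.exp (Real.pi ^ 2 / 6 * (n / (1 - r))) with hE
  have hw0 : 0 < w := Real.rpow_pos_of_pos hs _
  have hw1 : w ≤ 1 := Real.rpow_le_one hs.le (by linarith [h.1]) (by positivity)
  have hE0 : 0 < E := Real.exp_pos _
  have hEm : Real.exp (Real.pi ^ 2 / 6 * ((m : ℝ) * n / (1 - r))) = E ^ m := by
    rw [hE, ← Real.exp_nat_mul]
    congr 1
    ring
  have hdiv : ((1 - r) / (2 * Real.pi)) ^ ((n : ℝ) / 2) = w / P :=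
    Real.div_rpow hs.le (by positivity) _
  have hinv : 1 / renewalProb n ⟨r, h⟩ ≤ c * (w * E) := hu ⟨r, h⟩ hr.1.le
  calc 2 * m.factorial * (12 * n / ((1 - r) * renewalProb n ⟨r, h⟩)) ^ m
      = 2 * m.factorial * (12 * n / (1 - r) * (1 / renewalProb n ⟨r, h⟩)) ^ m := by
        congr 2
        field_simp
    _ ≤ 2 * m.factorial * (12 * n / (1 - r) * (c * (w * E))) ^ m := by gcongr
    _ = A * (w ^ m * E ^ m / P / (1 - r) ^ m) := by
        rw [hA]
        simp only [mul_pow, div_pow]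
        field_simp
    _ ≤ (Z r * (1 - r)) ^ m * (w * E ^ m / P / (1 - r) ^ m) := by
        gcongr
        · exact pow_nonneg (zero_le_one.trans ((le_max_right A 1).trans hZ)) m
        -- The method gives (1-r)^{mn/2}; the claimed exponent n/2 is weaker because m ≥ 1.
        · exact pow_le_of_le_one hw0.le hw1 (by omega)
    _ = upperRate n m r := by
        rw [upperRate, hEm, hdiv, mul_pow]
        field_simp

/-- Exponent budget with y = 1/(1-r), per m-th power: the moment supplies e^{y/4} up to a constant;
Z_r and the exponential factor cost e^{y/16} each, and the constants gathered in `A` cost e^{y/8}.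
-/
lemma eventually_le_moment (n m : ℕ) (hn : 1 ≤ n) (hm : 1 ≤ m) {δ : ℝ → ℝ}
    (hδ : Tendsto δ (𝓝[<] 1) (𝓝 0)) :
    ∀ᶠ r in 𝓝[<] (1 : ℝ), ∀ h : r ∈ Set.Ioo (0 : ℝ) 1,
      ENNReal.ofReal (lowerRate n m (δ r) r) ≤ moment n m ⟨r, h⟩ := by
  have hinv : Tendsto (fun r : ℝ => 1 / (1 - r)) (𝓝[<] 1) atTop := by
    simp only [one_div]
    exact tendsto_inv_nhdsGT_zero.comp tendsto_one_sub
  have hexp : Tendsto (fun r : ℝ => Real.exp (1 / (1 - r) / 8)) (𝓝[<] 1) atTop :=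
    Real.tendsto_exp_atTop.comp (hinv.atTop_div_const (by norm_num))
  set A : ℝ := m.factorial * (512 * Real.exp (4 * n ^ 2)) ^ m * (2 * (4 * Real.exp (1 / 2)) ^ m)
    with hA
  filter_upwards [eventually_mem_Ioo, hδ.eventually_lt_const (by norm_num : (0 : ℝ) < 1 / 2),
    hinv.eventually_ge_atTop 8, hexp.eventually_ge_atTop (max A 1)] with r hr hδr h8 hAr h
  have hs : 0 < 1 - r := by linarith [h.2]
  set y : ℝ := 1 / (1 - r) with hy
  have hpos := renewalProb_pos ⟨r, h⟩ n
  have hAm : A ≤ Real.exp (y / 8) ^ m :=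
    (le_max_left A 1).trans (hAr.trans (le_self_pow₀ ((le_max_right A 1).trans hAr) (by omega)))
  have hule : renewalProb n ⟨r, h⟩ ≤ Real.exp (1 / 2 - y / 4) := by
    refine (renewalProb_le_exp hn ⟨r, h⟩).trans (le_of_eq ?_)
    congr 2
    rw [hy]
    field_simp
  -- The largest `k` admitted by `le_moment` is ⌊x⌋.
  set x : ℝ := 1 / (2 * renewalProb n ⟨r, h⟩) with hx
  have hxge : Real.exp (y / 4) / (2 * Real.exp (1 / 2)) ≤ x := by
    rw [hx, div_le_div_iff₀ (by positivity) (by positivity)]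
    have h1 : Real.exp (y / 4) * Real.exp (1 / 2 - y / 4) = Real.exp (1 / 2) := by
      rw [← Real.exp_add]
      congr 1
      ring
    nlinarith [mul_le_mul_of_nonneg_left hule (Real.exp_pos (y / 4)).le]
  have hx1 : 1 ≤ x := by
    refine le_trans ?_ hxge
    rw [le_div_iff₀ (by positivity), one_mul]
    have h1 : Real.exp (y / 4) ≥ Real.exp (1 / 2 + 1) := Real.exp_le_exp.2 (by linarith)
    rw [Real.exp_add] at h1
    nlinarith [Real.add_one_le_exp (1 : ℝ), Real.exp_pos (1 / 2 : ℝ)]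
  have hk : (⌊x⌋₊ : ℝ) * renewalProb n ⟨r, h⟩ ≤ 1 / 2 := by
    have h1 := Nat.floor_le (zero_le_one.trans hx1)
    calc (⌊x⌋₊ : ℝ) * renewalProb n ⟨r, h⟩ ≤ x * renewalProb n ⟨r, h⟩ := by gcongr
      _ = 1 / 2 := by rw [hx]; field_simp
  refine le_trans (ENNReal.ofReal_le_ofReal ?_) (le_moment ⟨r, h⟩ hn m hk)
  have hfloor : Real.exp (y / 4) / (4 * Real.exp (1 / 2)) ≤ ⌊x⌋₊ := by
    have h1 := Nat.lt_floor_add_one x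
    have h2 : (1 : ℝ) ≤ ⌊x⌋₊ := by exact_mod_cast Nat.le_floor (by exact_mod_cast hx1)
    have h3 : Real.exp (y / 4) / (4 * Real.exp (1 / 2))
        = Real.exp (y / 4) / (2 * Real.exp (1 / 2)) / 2 := by
      field_simp
      norm_num
    rw [h3]
    linarith
  have hZ : Z r ≤ 512 * Real.exp (y / 16) := by
    refine (Z_le h).trans ?_
    have := Real.pow_div_factorial_le_exp (x := y / 16) (by positivity) 2
    norm_num at this
    rw [← hy]
    nlinarith
  have hpow : n / (1 - r) ^ δ r ≤ y / 16 + 4 * n ^ 2 := by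
    have h1 : (1 - r) ^ (1 / 2 : ℝ) ≤ (1 - r) ^ δ r :=
      Real.rpow_le_rpow_of_exponent_ge hs (by linarith [h.1]) hδr.le
    have h2 : 0 < (1 - r) ^ (1 / 2 : ℝ) := Real.rpow_pos_of_pos hs _
    refine (div_le_div_of_nonneg_left (Nat.cast_nonneg n) h2 h1).trans ?_
    have h3 : (1 / (1 - r) ^ (1 / 2 : ℝ)) ^ 2 = y := by
      rw [div_pow, ← Real.rpow_mul_natCast hs.le, hy]
      norm_num
    rw [div_eq_mul_one_div, ← h3]
    -- The square expresses n√y ≤ y/16 + 4n².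
    nlinarith [sq_nonneg (1 / (1 - r) ^ (1 / 2 : ℝ) / 4 - 2 * n)]
  have hexpm : Real.exp ((m : ℝ) * n / (1 - r) ^ δ r)
      ≤ (Real.exp (y / 16) * Real.exp (4 * n ^ 2)) ^ m := by
    rw [← Real.exp_add, ← Real.exp_nat_mul, mul_div_assoc]
    exact Real.exp_le_exp.2 (by gcongr)
  have hZ0 := Z_nonneg h
  have he8 : Real.exp (y / 16) * Real.exp (y / 16) = Real.exp (y / 8) := by
    rw [← Real.exp_add]
    congr 1
    ring
  have he4 : Real.exp (y / 8) * Real.exp (y / 8) = Real.exp (y / 4) := by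
    rw [← Real.exp_add]
    congr 1
    ring
  calc lowerRate n m (δ r) r
      ≤ m.factorial * (512 * Real.exp (y / 16)) ^ m *
        (Real.exp (y / 16) * Real.exp (4 * n ^ 2)) ^ m := by
        rw [lowerRate]
        gcongr
    _ = A * Real.exp (y / 8) ^ m / (2 * (4 * Real.exp (1 / 2)) ^ m) := by
        rw [hA, ← he8]
        simp only [mul_pow]
        field_simp
    _ ≤ Real.exp (y / 8) ^ m * Real.exp (y / 8) ^ m / (2 * (4 * Real.exp (1 / 2)) ^ m) := by
        gcongr
    _ = (Real.exp (y / 4) / (4 * Real.exp (1 / 2))) ^ m / 2 := by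
        rw [← he4, div_pow, mul_pow (Real.exp (y / 8))]
        exact div_mul_eq_div_div_swap _ _ _
    _ ≤ (⌊x⌋₊ : ℝ) ^ m / 2 := by gcongr

end FrogModel

/-! ### Comparison functions on all of (0,1) -/

theorem mainTheorem6 (n m : ℕ) (hn : 1 ≤ n) (hm : 1 ≤ m) :
    (∃ φ : ℝ → ℝ≥0,
      (∀ ρ : Set.Ioo (0 : ℝ) 1, FrogModel.moment n m ρ ≤ (φ ρ : ℝ≥0∞)) ∧
      (fun ρ : ℝ => (φ ρ : ℝ)) ~[𝓝[<] 1]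
        (fun ρ : ℝ => FrogModel.Z ρ ^ m * ((1 - ρ) / (2 * Real.pi)) ^ ((n : ℝ) / 2) *
          Real.exp (Real.pi ^ 2 / 6 * ((m : ℝ) * n / (1 - ρ))))) ∧
    (∀ δ : ℝ → ℝ, (∀ ρ ∈ Set.Ioo (0 : ℝ) 1, δ ρ ∈ Set.Ioo (0 : ℝ) 1) →
      Tendsto δ (𝓝[<] 1) (𝓝 0) →
      Tendsto (fun ρ : ℝ => (1 - ρ) ^ δ ρ) (𝓝[<] 1) (𝓝 0) →
      ∃ ψ : ℝ → ℝ≥0,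
        (∀ ρ : Set.Ioo (0 : ℝ) 1, (ψ ρ : ℝ≥0∞) ≤ FrogModel.moment n m ρ) ∧
        (fun ρ : ℝ => (ψ ρ : ℝ)) ~[𝓝[<] 1]
          (fun ρ : ℝ => (m.factorial : ℝ) * FrogModel.Z ρ ^ m *
            Real.exp ((m : ℝ) * n / (1 - ρ) ^ δ ρ))) := by
  classical
  have hmem : ∀ᶠ r in 𝓝[<] (1 : ℝ), r ∈ Set.Ioo (0 : ℝ) 1 := Ioo_mem_nhdsLT (by norm_num)
  have hfin : ∀ ρ, FrogModel.moment n m ρ ≠ ∞ := fun ρ =>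
    ((FrogModel.moment_le ρ hn m).trans_lt ENNReal.ofReal_lt_top).ne
  constructor
  -- The maximum bounds the moment for every ρ and equals the rate near 1; `hfin` makes it finite.
  · refine ⟨fun r => if h : r ∈ Set.Ioo (0 : ℝ) 1 then
      max (FrogModel.moment n m ⟨r, h⟩).toNNReal (FrogModel.upperRate n m r).toNNReal else 0,
      fun ρ => ?_, ?_⟩
    · simp only [dif_pos ρ.2]
      calc FrogModel.moment n m ρ = ((FrogModel.moment n m ρ).toNNReal : ℝ≥0∞) :=
            (ENNReal.coe_toNNReal (hfin ρ)).symm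
        _ ≤ _ := ENNReal.coe_le_coe.2 (le_max_left _ _)
    · refine Filter.EventuallyEq.isEquivalent ?_
      filter_upwards [hmem, FrogModel.eventually_moment_le n m hn hm] with r hr hle
      have h0 : 0 ≤ FrogModel.upperRate n m r := by
        have := FrogModel.Z_nonneg hr
        have : 0 ≤ 1 - r := by linarith [hr.2]
        unfold FrogModel.upperRate
        positivity
      have hle' : (FrogModel.moment n m ⟨r, hr⟩).toNNReal
          ≤ (FrogModel.upperRate n m r).toNNReal :=
        ENNReal.toNNReal_mono ENNReal.ofReal_ne_top (hle hr)
      rw [dif_pos hr, max_eq_right hle',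
        Real.coe_toNNReal _ h0]
      rfl
  · intro δ _ hδ _
    -- Dually, the minimum lies below the moment everywhere and equals the rate near 1.
    refine ⟨fun r => if h : r ∈ Set.Ioo (0 : ℝ) 1 then
      min (FrogModel.moment n m ⟨r, h⟩).toNNReal (FrogModel.lowerRate n m (δ r) r).toNNReal else 0,
      fun ρ => ?_, ?_⟩
    · simp only [dif_pos ρ.2]
      calc _ ≤ ((FrogModel.moment n m ρ).toNNReal : ℝ≥0∞) :=
            ENNReal.coe_le_coe.2 (min_le_left _ _)
        _ = FrogModel.moment n m ρ := ENNReal.coe_toNNReal (hfin ρ)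
    · refine Filter.EventuallyEq.isEquivalent ?_
      filter_upwards [hmem, FrogModel.eventually_le_moment n m hn hm hδ] with r hr hle
      have h0 : 0 ≤ FrogModel.lowerRate n m (δ r) r := by
        have := FrogModel.Z_nonneg hr
        unfold FrogModel.lowerRate
        positivity
      have hle' : (FrogModel.lowerRate n m (δ r) r).toNNReal
          ≤ (FrogModel.moment n m ⟨r, hr⟩).toNNReal :=
        ENNReal.le_toNNReal_of_coe_le (hle hr) (hfin _)
      rw [dif_pos hr, min_eq_right hle', Real.coe_toNNReal _ h0]
      rfl
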